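/- Let $(R,\mu)$ be a $\sigma$-finite measure space and let $M=M(R,\mu)$ be the set of extended complex-valued $\mu$-measurable functions on $R$, functions equal $\mu$-a.e. being identified. For $f\in M$ put $\mu_f(s)=\mu(\{|f|>s\})$, $s\ge 0$, and $f^*(t)=\inf\{s\in[0,\infty):\mu_f(s)\le t\}$, $t\ge 0$. Let $\lambda$ be Lebesgue measure on $[0,\infty)$. The space $(R,\mu)$ is called resonant if $\sup_{\tilde g^*=g^*}\int_R|f\tilde g|\,d\mu=\int_0^\infty f^*g^*\,d\lambda$ for all $f,g\in M$; assume that $(R,\mu)$ is resonant. A functional $\|\cdot\|:M\to[0,\infty]$ with $\|\,|f|\,\|=\|f\|$ is a Banach function norm if, for all measurable $f,g,f_n\ge 0$: (P1) $\|af\|=|a|\|f\|$ for $a\in\mathbb{C}$, $\|f\|=0\Leftrightarrow f=0$ a.e., and $\|f+g\|\le\|f\|+\|g\|$; (P2) $f\le g$ a.e. implies $\|f\|\le\|g\|$; (P3) $f_n\uparrow f$ a.e. implies $\|f_n\|\uparrow\|f\|$; (P4) $\|\chi_E\|<\infty$ whenever $\mu(E)<\infty$; (P5) whenever $\mu(E)<\infty$,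 there is a finite $C_E$ with $\int_E f\,d\mu\le C_E\|f\|$ for all $f\ge0$. It is a quasi-Banach function norm if it satisfies (P2), (P3), (P4) and (P1) with the triangle inequality weakened to $\|f+g\|\le C(\|f\|+\|g\|)$ for some constant $C\ge1$. It is rearrangement-invariant (r.i.) if $\|f\|=\|g\|$ whenever $\mu_f=\mu_g$. Two functionals are equivalent if each is bounded by a constant multiple of the other. For a functional $\|\cdot\|_X$ put $X=\{f\in M:\|f\|_X<\infty\}$; $X\hookrightarrow Y$ means that $X\subseteq Y$ and the identity $X\to Y$ is continuous. For an r.i. quasi-Banach function norm $\|\cdot\|_X$ define the integrable norm $$\|f\|_{X_i}=\max\Big\{\|f\|_X,\ \|f^*\chi_{[0,1]}\|_{L^1(0,\infty)}+\|f^*\chi_{(1,\infty)}\|_{L^\infty(0,\infty)}\Big\},$$ the integrable associate norm $$\|f\|_{X_i'}=\sup\Big\{\tfrac{1}{\|g\|_{X_i}}\int_R|fg|\,d\mu:\ g\in M,\ \|g\|_{X_i}<\infty\Big\}\qquad\big(\tfrac00=0,\ \tfrac a0=\infty\text{ for }a>0\big),$$ and the second integrable associate norm $\|\cdot\|_{X_i''}$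 as the integrable associate norm of $\|\cdot\|_{X_i'}$; let $X_i''$ be the corresponding space. Theorem. Let $\|\cdot\|_X$ be an r.i. quasi-Banach function norm over the resonant space $(R,\mu)$ and let $X$ be the corresponding space. Then: 1. if $\|\cdot\|_X$ is a Banach function norm, then $X=X_i''$ with equivalent norms; 2. if $\|\cdot\|_X$ has the property (P5) but is not equivalent to a Banach function norm, then $X\hookrightarrow X_i''$ and $X_i''\not\hookrightarrow X$; 3. if $\|\cdot\|_X$ has the property (P1) but not the property (P5), then $X_i''\hookrightarrow X$ and $X\not\hookrightarrow X_i''$; 4. if $\|\cdot\|_X$ has neither (P1) nor (P5), then $X$ and $X_i''$ cannot, in general, be compared. Precisely, $([0,\infty),\lambda)$ is resonant, and for every $p\in(0,1)$ the functional $\|f\|_p=\big(\int_0^\infty|f|^p\,d\lambda\big)^{1/p}$ is an r.i. quasi-Banach function norm over it that has neither (P1) nor (P5), and both $L^p\not\subseteq(L^p)_i''$ and $(L^p)_i''\not\subseteq L^p$. -/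

import Mathlib

open MeasureTheory Filter Topology Set
open scoped ENNReal NNReal

namespace RIFunctionSpace

variable {R : Type*} [MeasurableSpace R]

/-! A functional `‖·‖ : M(R, μ) → [0, ∞]` with `‖ |f| ‖ = ‖f‖` is determined by its values on the
non-negative extended-valued functions, so it is represented by a map
`ρ : (R → ℝ≥0∞) → ℝ≥0∞`, of which only the values at `μ`-measurable functions
(`AEMeasurable f μ`) ever matter; `‖f‖` for a complex `f` is `ρ |f|`. Functions that agree
`μ`-a.e. have the same norm by the lattice property `P2`. -/

/-- The distribution function `μ_f(s) = μ {|f| > s}`, `s ∈ [0, ∞)`. -/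
noncomputable def distribution (μ : Measure R) (f : R → ℝ≥0∞) (s : ℝ≥0) : ℝ≥0∞ :=
  μ {x | (s : ℝ≥0∞) < f x}

/-- The non-increasing rearrangement `f^*(t) = inf {s ∈ [0, ∞) : μ_f(s) ≤ t}`, for `t ∈ [0, ∞)`
(with `inf ∅ = ∞`). It is only ever used for `t ≥ 0`. -/
noncomputable def rearrangement (μ : Measure R) (f : R → ℝ≥0∞) (t : ℝ) : ℝ≥0∞ :=
  ⨅ (s : ℝ≥0) (_ : distribution μ f s ≤ ENNReal.ofReal t), (s : ℝ≥0∞)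

/-- The Lebesgue measure on the half-line `[0, ∞)`. -/
noncomputable def halfLine : Measure ℝ := volume.restrict (Ici (0 : ℝ))

instance : SigmaFinite halfLine := by
  unfold halfLine; infer_instance

/-- A (sigma-finite) measure space is resonant if the supremum of `∫ |f g̃| dμ` over all `g̃`
with `g̃^* = g^*` is `∫_0^∞ f^* g^* dλ`, for all measurable `f`, `g`. -/
def IsResonant (μ : Measure R) : Prop :=
  ∀ f g : R → ℝ≥0∞, AEMeasurable f μ → AEMeasurable g μ →
    (⨆ (h : R → ℝ≥0∞) (_ : AEMeasurable h μ)
        (_ : ∀ t : ℝ, 0 ≤ t → rearrangement μ h t = rearrangement μ g t),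
      ∫⁻ x, f x * h x ∂μ)
    = ∫⁻ t, rearrangement μ f t * rearrangement μ g t ∂halfLine

/-- Axiom (P1): norm. -/
structure HasP1 (μ : Measure R) (ρ : (R → ℝ≥0∞) → ℝ≥0∞) : Prop where
  homogeneous : ∀ (a : ℝ≥0) (f : R → ℝ≥0∞), AEMeasurable f μ →
    ρ (fun x => a * f x) = a * ρ f
  eq_zero_iff : ∀ f : R → ℝ≥0∞, AEMeasurable f μ → (ρ f = 0 ↔ ∀ᵐ x ∂μ, f x = 0)
  subadditive : ∀ f g : R → ℝ≥0∞, AEMeasurable f μ → AEMeasurable g μ →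
    ρ (fun x => f x + g x) ≤ ρ f + ρ g

/-- Axiom (Q1): quasinorm. -/
structure HasQ1 (μ : Measure R) (ρ : (R → ℝ≥0∞) → ℝ≥0∞) : Prop where
  homogeneous : ∀ (a : ℝ≥0) (f : R → ℝ≥0∞), AEMeasurable f μ →
    ρ (fun x => a * f x) = a * ρ f
  eq_zero_iff : ∀ f : R → ℝ≥0∞, AEMeasurable f μ → (ρ f = 0 ↔ ∀ᵐ x ∂μ, f x = 0)
  quasi_subadditive : ∃ C : ℝ≥0, 1 ≤ C ∧
    ∀ f g : R → ℝ≥0∞, AEMeasurable f μ → AEMeasurable g μ →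
      ρ (fun x => f x + g x) ≤ C * (ρ f + ρ g)

/-- Axiom (P2): lattice property. -/
def HasP2 (μ : Measure R) (ρ : (R → ℝ≥0∞) → ℝ≥0∞) : Prop :=
  ∀ f g : R → ℝ≥0∞, AEMeasurable f μ → AEMeasurable g μ → (∀ᵐ x ∂μ, f x ≤ g x) → ρ f ≤ ρ g

/-- Axiom (P3): Fatou property. -/
def HasP3 (μ : Measure R) (ρ : (R → ℝ≥0∞) → ℝ≥0∞) : Prop :=
  ∀ (u : ℕ → R → ℝ≥0∞) (f : R → ℝ≥0∞), (∀ n, AEMeasurable (u n) μ) → AEMeasurable f μ →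
    (∀ᵐ x ∂μ, Monotone (fun n => u n x) ∧ Tendsto (fun n => u n x) atTop (𝓝 (f x))) →
    Monotone (fun n => ρ (u n)) ∧ Tendsto (fun n => ρ (u n)) atTop (𝓝 (ρ f))

/-- Axiom (P4): characteristic functions of sets of finite measure have finite norm. -/
def HasP4 (μ : Measure R) (ρ : (R → ℝ≥0∞) → ℝ≥0∞) : Prop :=
  ∀ E : Set R, MeasurableSet E → μ E < ∞ → ρ (E.indicator (fun _ => 1)) < ∞

/-- Axiom (P5): local embedding into `L^1`. -/
def HasP5 (μ : Measure R) (ρ : (R → ℝ≥0∞) → ℝ≥0∞) : Prop :=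
  ∀ E : Set R, MeasurableSet E → μ E < ∞ → ∃ C : ℝ≥0,
    ∀ f : R → ℝ≥0∞, AEMeasurable f μ → ∫⁻ x in E, f x ∂μ ≤ C * ρ f

/-- Banach function norms. -/
structure IsBanachFunctionNorm (μ : Measure R) (ρ : (R → ℝ≥0∞) → ℝ≥0∞) : Prop where
  p1 : HasP1 μ ρ
  p2 : HasP2 μ ρ
  p3 : HasP3 μ ρ
  p4 : HasP4 μ ρ
  p5 : HasP5 μ ρ

/-- Quasi-Banach function norms. -/
structure IsQuasiBanachFunctionNorm (μ : Measure R) (ρ : (R → ℝ≥0∞) → ℝ≥0∞) : Prop where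
  q1 : HasQ1 μ ρ
  p2 : HasP2 μ ρ
  p3 : HasP3 μ ρ
  p4 : HasP4 μ ρ

/-- Rearrangement invariance: equimeasurable functions have the same norm. -/
def IsRearrangementInvariant (μ : Measure R) (ρ : (R → ℝ≥0∞) → ℝ≥0∞) : Prop :=
  ∀ f g : R → ℝ≥0∞, AEMeasurable f μ → AEMeasurable g μ →
    (∀ s : ℝ≥0, distribution μ f s = distribution μ g s) → ρ f = ρ g

/-- Rearrangement-invariant quasi-Banach function norms. -/
structure IsRIQuasiBanachFunctionNorm (μ : Measure R) (ρ : (R → ℝ≥0∞) → ℝ≥0∞) : Prop where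
  quasiBanach : IsQuasiBanachFunctionNorm μ ρ
  invariant : IsRearrangementInvariant μ ρ

/-- Equivalence of two functionals on `M`. -/
def Equivalent (μ : Measure R) (ρ σ : (R → ℝ≥0∞) → ℝ≥0∞) : Prop :=
  ∃ C : ℝ≥0, 0 < C ∧ ∀ f : R → ℝ≥0∞, AEMeasurable f μ → ρ f ≤ C * σ f ∧ σ f ≤ C * ρ f

/-- The norm `ρ |f|` of a complex function. -/
noncomputable def cnorm {μ : Measure R} (ρ : (R → ℝ≥0∞) → ℝ≥0∞) (f : R →ₘ[μ] ℂ) : ℝ≥0∞ :=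
  ρ (fun x => ‖f x‖ₑ)

/-- The space `X = {f : ‖f‖_X < ∞}` of (classes of) functions. Functions of finite quasi-Banach
function norm are finite a.e., so complex-valued functions suffice. -/
def space (μ : Measure R) (ρ : (R → ℝ≥0∞) → ℝ≥0∞) : Set (R →ₘ[μ] ℂ) :=
  {f | cnorm ρ f < ∞}

/-- `X ↪ Y`: `X ⊆ Y` and the identity `X → Y` is continuous. The topology of a quasinormed space
is metrizable and its convergent sequences are those with `‖f_n - f‖ → 0`, so continuity is
sequential continuity. -/
def Embeds (μ : Measure R) (ρ σ : (R → ℝ≥0∞) → ℝ≥0∞) : Prop :=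
  space μ ρ ⊆ space μ σ ∧
    ∀ (u : ℕ → R →ₘ[μ] ℂ) (f : R →ₘ[μ] ℂ), (∀ n, u n ∈ space μ ρ) → f ∈ space μ ρ →
      Tendsto (fun n => cnorm ρ (u n - f)) atTop (𝓝 0) →
      Tendsto (fun n => cnorm σ (u n - f)) atTop (𝓝 0)

/-- The Lebesgue functional `‖·‖_p`. -/
noncomputable def lebesgueNorm (μ : Measure R) (p : ℝ≥0∞) (f : R → ℝ≥0∞) : ℝ≥0∞ :=
  eLpNorm f p μ

/-- The Wiener–Luxemburg quasinorm `‖f^* χ_[0,1]‖_A + ‖f^* χ_(1,∞)‖_B`, where `A`, `B` are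
functionals over `[0, ∞)`. -/
noncomputable def wienerLuxemburg (μ : Measure R) (A B : (ℝ → ℝ≥0∞) → ℝ≥0∞)
    (f : R → ℝ≥0∞) : ℝ≥0∞ :=
  A ((Icc (0 : ℝ) 1).indicator (rearrangement μ f)) +
    B ((Ioi (1 : ℝ)).indicator (rearrangement μ f))

/-- The integrable norm `‖f‖_{X_i} = max {‖f‖_X, ‖f‖_{WL(L^1, L^∞)}}`. -/
noncomputable def integrableNorm (μ : Measure R) (ρ : (R → ℝ≥0∞) → ℝ≥0∞)
    (f : R → ℝ≥0∞) : ℝ≥0∞ :=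
  max (ρ f) (wienerLuxemburg μ (lebesgueNorm halfLine 1) (lebesgueNorm halfLine ∞) f)

/-- The associate functional `‖f‖_{X'} = sup_{g ∈ X} ‖g‖_X⁻¹ ∫ |f g| dμ`. In `ℝ≥0∞`, as required,
`0 / 0 = 0` and `a / 0 = ∞` for `a > 0`. -/
noncomputable def associateNorm (μ : Measure R) (ρ : (R → ℝ≥0∞) → ℝ≥0∞)
    (f : R → ℝ≥0∞) : ℝ≥0∞ :=
  ⨆ (g : R → ℝ≥0∞) (_ : AEMeasurable g μ) (_ : ρ g < ∞), (∫⁻ x, f x * g x ∂μ) / ρ g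

/-- The integrable associate norm `‖·‖_{X_i'}`. -/
noncomputable def integrableAssociateNorm (μ : Measure R) (ρ : (R → ℝ≥0∞) → ℝ≥0∞) :
    (R → ℝ≥0∞) → ℝ≥0∞ :=
  associateNorm μ (integrableNorm μ ρ)

/-- The second integrable associate norm `‖·‖_{X_i''}`: the integrable associate norm of
`‖·‖_{X_i'}`. -/
noncomputable def secondIntegrableAssociateNorm (μ : Measure R) (ρ : (R → ℝ≥0∞) → ℝ≥0∞) :
    (R → ℝ≥0∞) → ℝ≥0∞ :=
  integrableAssociateNorm μ (integrableAssociateNorm μ ρ)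

end RIFunctionSpace

/-!
A continuous embedding of quasi-normed function spaces is a domination of their functionals, so
only dominations between `ρ` and `ρ_i''` matter, and `ρ_i''` is always a Banach function norm.

If `ρ` has (P1), then Hahn–Banach separation in `L²` yields the Lorentz–Luxemburg theorem
`ρ ≤ ρ''`. The norm of `X_i'` is rearrangement-invariant and has (P5); on a resonant space (P5)
improves to domination of the norm of `L¹ + L^∞`, hence passing from `X_i'` to its integrable norm
changes nothing up to equivalence, and `ρ ≲ ρ_i''`. If instead `ρ` has (P5), the same improvement
gives `ρ_i ≲ ρ`, whence `ρ_i'' ≲ ρ`.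

For `p < 1` the function `x⁻¹ χ_(0,1)` is in `L^p` but not locally integrable, while
`x^(-1/p) χ_(1,∞)` is integrable, hence in `(L^p)_i''`, but not in `L^p`. The half-line is resonant
because the points of an atomless measure on the line can be ranked by the values of a function,
ties being broken by position; composing `g^*` with the rank of `f` gives an equimeasurable copy of
`g` that is aligned with `f`.
-/

namespace RIFunctionSpace

variable {R : Type*} [MeasurableSpace R] {μ : Measure R} {f g : R → ℝ≥0∞}

/-! ### Distribution functions and rearrangements -/

instance : NullSingletonClass halfLine := by
  unfold halfLine; infer_instance

theorem halfLine_setOf_ofReal_lt (a : ℝ≥0∞) : halfLine {t | ENNReal.ofReal t < a} = a := by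
  rw [halfLine, Measure.restrict_apply' measurableSet_Ici]
  induction a with
  | top => simp
  | coe a =>
    have : {t : ℝ | ENNReal.ofReal t < a} ∩ Ici 0 = Ico 0 (a : ℝ) := by
      ext t
      refine ⟨fun ⟨ht, h0⟩ => ⟨h0, ?_⟩, fun ⟨h0, ht⟩ => ⟨?_, h0⟩⟩
      · exact (ENNReal.ofReal_lt_coe_iff h0).1 ht
      · exact (ENNReal.ofReal_lt_coe_iff h0).2 ht
    rw [this, Real.volume_Ico, sub_zero, ENNReal.ofReal_coe_nnreal]

theorem halfLine_Iic (x : ℝ) : halfLine (Iic x) = ENNReal.ofReal x := by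
  rw [halfLine, Measure.restrict_apply' measurableSet_Ici, inter_comm, Ici_inter_Iic,
    Real.volume_Icc, sub_zero]

theorem lintegral_eq_lintegral_distribution [SFinite μ] (hf : AEMeasurable f μ) :
    ∫⁻ x, f x ∂μ = ∫⁻ s, distribution μ f s.toNNReal ∂halfLine := by
  obtain ⟨f', hf', hff'⟩ := hf
  have hdist (s : ℝ≥0) : distribution μ f s = distribution μ f' s :=
    measure_congr (hff'.mono fun x hx => congrArg ((s : ℝ≥0∞) < ·) hx)
  have hms : MeasurableSet {q : R × ℝ | ENNReal.ofReal q.2 < f' q.1} :=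
    measurableSet_lt (by fun_prop) (by fun_prop)
  calc ∫⁻ x, f x ∂μ = ∫⁻ x, f' x ∂μ := lintegral_congr_ae hff'
    _ = (μ.prod halfLine) {q | ENNReal.ofReal q.2 < f' q.1} := by
        rw [Measure.prod_apply hms]
        exact lintegral_congr fun x => (halfLine_setOf_ofReal_lt (f' x)).symm
    _ = ∫⁻ s, distribution μ f' s.toNNReal ∂halfLine := Measure.prod_apply_symm hms
    _ = ∫⁻ s, distribution μ f s.toNNReal ∂halfLine := by simp only [hdist]

theorem setLIntegral_eq_lintegral_measure_inter [SFinite μ] (hf : AEMeasurable f μ) {E : Set R}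
    (hE : NullMeasurableSet E μ) :
    ∫⁻ x in E, f x ∂μ = ∫⁻ s, μ ({x | ENNReal.ofReal s < f x} ∩ E) ∂halfLine := by
  rw [lintegral_eq_lintegral_distribution hf.restrict]
  exact lintegral_congr fun s => Measure.restrict_apply₀' hE

theorem lintegral_mul_eq_lintegral_lintegral_measure_inter [SFinite μ] (hf : AEMeasurable f μ)
    (hg : AEMeasurable g μ) :
    ∫⁻ x, f x * g x ∂μ = ∫⁻ s, ∫⁻ t,
      μ ({x | ENNReal.ofReal s < f x} ∩ {x | ENNReal.ofReal t < g x}) ∂halfLine ∂halfLine := by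
  have hgf : AEMeasurable f (μ.withDensity g) :=
    hf.mono_ac (withDensity_absolutelyContinuous μ g)
  calc ∫⁻ x, f x * g x ∂μ = ∫⁻ x, f x ∂μ.withDensity g := by
        rw [lintegral_withDensity_eq_lintegral_mul₀' hg hgf]
        exact lintegral_congr fun x => mul_comm _ _
    _ = ∫⁻ s, μ.withDensity g {x | ENNReal.ofReal s < f x} ∂halfLine :=
        lintegral_eq_lintegral_distribution hgf
    _ = _ := lintegral_congr fun s => by
        have hs : NullMeasurableSet {x | ENNReal.ofReal s < f x} μ :=
          nullMeasurableSet_lt aemeasurable_const hf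
        rw [withDensity_apply₀ _ hs, setLIntegral_eq_lintegral_measure_inter hg hs]
        simp only [inter_comm]

theorem distribution_antitone (μ : Measure R) (f : R → ℝ≥0∞) : Antitone (distribution μ f) :=
  fun _ _ hst => measure_mono fun _ hx => (ENNReal.coe_le_coe.2 hst).trans_lt hx

theorem distribution_mono (h : ∀ᵐ x ∂μ, f x ≤ g x) (s : ℝ≥0) :
    distribution μ f s ≤ distribution μ g s :=
  measure_mono_ae (h.mono fun _ hx hs => lt_of_lt_of_le hs hx)

theorem distribution_indicator_one (μ : Measure R) (E : Set R) (s : ℝ≥0) :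
    distribution μ (E.indicator fun _ => 1) s = if s < 1 then μ E else 0 := by
  have (x : R) : (s : ℝ≥0∞) < E.indicator (fun _ => 1) x ↔ s < 1 ∧ x ∈ E := by
    by_cases hx : x ∈ E <;> simp [hx]
  simp only [distribution, this]
  split_ifs with hs <;> simp [hs]

theorem rearrangement_le_iff {t : ℝ} {s : ℝ≥0} :
    rearrangement μ f t ≤ s ↔ distribution μ f s ≤ ENNReal.ofReal t := by
  refine ⟨fun h => ?_, fun h => iInf₂_le s h⟩
  obtain ⟨u, hu, hsu, hlim⟩ := exists_seq_strictAnti_tendsto s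
  have hunion : {x | (s : ℝ≥0∞) < f x} = ⋃ n, {x | (u n : ℝ≥0∞) < f x} := by
    ext x
    rw [mem_iUnion]
    refine ⟨fun hx => ?_, fun ⟨n, hn⟩ => (ENNReal.coe_lt_coe.2 (hsu n)).trans hn⟩
    exact ((ENNReal.tendsto_coe.2 hlim).eventually_lt_const hx).exists
  have hmono : Monotone fun n => {x | (u n : ℝ≥0∞) < f x} := fun m n hmn x hx =>
    (ENNReal.coe_le_coe.2 (hu.antitone hmn)).trans_lt hx
  rw [distribution, hunion, hmono.measure_iUnion]
  refine iSup_le fun n => ?_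
  have hlt : rearrangement μ f t < u n := h.trans_lt (ENNReal.coe_lt_coe.2 (hsu n))
  simp only [rearrangement, iInf_lt_iff] at hlt
  obtain ⟨s', hs', hs'u⟩ := hlt
  exact (distribution_antitone μ f (ENNReal.coe_le_coe.1 hs'u.le)).trans hs'

theorem lt_rearrangement_iff {t : ℝ} {s : ℝ≥0} :
    (s : ℝ≥0∞) < rearrangement μ f t ↔ ENNReal.ofReal t < distribution μ f s := by
  rw [← not_le, rearrangement_le_iff, not_le]

theorem rearrangement_antitone (μ : Measure R) (f : R → ℝ≥0∞) : Antitone (rearrangement μ f) :=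
  fun _ _ hst => iInf₂_mono' fun s hs => ⟨s, hs.trans (ENNReal.ofReal_le_ofReal hst), le_rfl⟩

theorem rearrangement_mono (h : ∀ᵐ x ∂μ, f x ≤ g x) (t : ℝ) :
    rearrangement μ f t ≤ rearrangement μ g t :=
  iInf₂_mono' fun s hs => ⟨s, (distribution_mono h s).trans hs, le_rfl⟩

theorem rearrangement_congr (h : f =ᵐ[μ] g) : rearrangement μ f = rearrangement μ g :=
  funext fun t => le_antisymm (rearrangement_mono h.le t) (rearrangement_mono h.symm.le t)

theorem rearrangement_iSup (μ : Measure R) {u : ℕ → R → ℝ≥0∞} (hu : Monotone u) (t : ℝ) :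
    rearrangement μ (fun x => ⨆ n, u n x) t = ⨆ n, rearrangement μ (u n) t := by
  refine ENNReal.eq_of_forall_le_nnreal_iff fun s => ?_
  have hmono : Monotone fun n => {x | (s : ℝ≥0∞) < u n x} :=
    fun m n hmn x hx => lt_of_lt_of_le hx (hu hmn x)
  simp only [iSup_le_iff, rearrangement_le_iff, distribution, lt_iSup_iff, ofPred_exists]
  rw [hmono.measure_iUnion, iSup_le_iff]

theorem measure_setOf_rearrangement_lt_le {t : ℝ} :
    μ {x | rearrangement μ f t < f x} ≤ ENNReal.ofReal t := by
  obtain h | h := eq_or_ne (rearrangement μ f t) ∞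
  · simp [h]
  · lift rearrangement μ f t to ℝ≥0 using h with s hs
    exact rearrangement_le_iff.1 hs.ge

theorem le_measure_setOf_rearrangement_le {t : ℝ} (hf : AEMeasurable f μ)
    (hsupp : μ {x | 0 < f x} ≠ ∞) (ht : ENNReal.ofReal t ≤ μ univ) :
    ENNReal.ofReal t ≤ μ {x | rearrangement μ f t ≤ f x} := by
  obtain h0 | h0 := eq_zero_or_pos (rearrangement μ f t)
  · simpa [h0] using ht
  obtain ⟨u, hu, hmem, hlim⟩ := exists_seq_strictMono_tendsto' h0
  have hInter : {x | rearrangement μ f t ≤ f x} = ⋂ n, {x | u n < f x} := by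
    ext x
    rw [mem_iInter]
    exact ⟨fun hx n => (hmem n).2.trans_le hx, fun hx => le_of_tendsto' hlim fun n => (hx n).le⟩
  have hanti : Antitone fun n => {x | u n < f x} :=
    fun m n hmn x hx => (hu.monotone hmn).trans_lt hx
  rw [hInter]
  refine ge_of_tendsto' (tendsto_measure_iInter_atTop
    (fun n => nullMeasurableSet_lt aemeasurable_const hf) hanti
    ⟨0, measure_ne_top_of_subset (fun x hx => (hmem 0).1.trans hx) hsupp⟩) fun n => ?_
  obtain ⟨s, hs⟩ : ∃ s : ℝ≥0, u n = s := ⟨_, (ENNReal.coe_toNNReal (hmem n).2.ne_top).symm⟩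
  rw [Function.comp_apply, hs]
  exact (lt_rearrangement_iff.1 (hs ▸ (hmem n).2)).le

theorem measurable_rearrangement (μ : Measure R) (f : R → ℝ≥0∞) :
    Measurable (rearrangement μ f) :=
  (rearrangement_antitone μ f).measurable

theorem rearrangement_eq_iff :
    (∀ t : ℝ, 0 ≤ t → rearrangement μ f t = rearrangement μ g t) ↔
      ∀ s, distribution μ f s = distribution μ g s := by
  refine ⟨fun h s => ENNReal.eq_of_forall_le_nnreal_iff fun r => ?_, fun h t _ => ?_⟩
  · rw [← ENNReal.ofReal_coe_nnreal (p := r), ← rearrangement_le_iff, ← rearrangement_le_iff,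
      h r r.2]
  · simp only [rearrangement, h]

theorem rearrangement_indicator_one (μ : Measure R) (E : Set R) :
    rearrangement μ (E.indicator fun _ => 1) =
      {t | ENNReal.ofReal t < μ E}.indicator fun _ => 1 := by
  ext t
  refine ENNReal.eq_of_forall_le_nnreal_iff fun r => ?_
  rw [rearrangement_le_iff, distribution_indicator_one]
  by_cases ht : ENNReal.ofReal t < μ E
  · rw [indicator_of_mem (by exact ht)]
    rcases lt_or_ge r 1 with hr | hr
    · simp [hr, ht.not_ge, hr.not_ge]
    · simp [hr, hr.not_gt]
  · rw [indicator_of_notMem (by exact ht)]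
    by_cases hr : r < 1 <;> simp [hr, not_lt.1 ht]

theorem lintegral_rearrangement_mul (μ : Measure R) (f g : R → ℝ≥0∞) :
    ∫⁻ t, rearrangement μ f t * rearrangement μ g t ∂halfLine =
      ∫⁻ s, ∫⁻ t, min (distribution μ f s.toNNReal) (distribution μ g t.toNNReal)
        ∂halfLine ∂halfLine := by
  rw [lintegral_mul_eq_lintegral_lintegral_measure_inter
    (measurable_rearrangement μ f).aemeasurable (measurable_rearrangement μ g).aemeasurable]
  refine lintegral_congr fun s => lintegral_congr fun t => ?_
  simp only [ENNReal.ofReal, lt_rearrangement_iff, ← ofPred_and, ← lt_min_iff]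
  exact halfLine_setOf_ofReal_lt _

theorem lintegral_rearrangement_iSup_mul (μ : Measure R) {u : ℕ → R → ℝ≥0∞} (hu : Monotone u)
    (g : R → ℝ≥0∞) :
    ∫⁻ t, rearrangement μ (fun x => ⨆ n, u n x) t * rearrangement μ g t ∂halfLine =
      ⨆ n, ∫⁻ t, rearrangement μ (u n) t * rearrangement μ g t ∂halfLine := by
  simp only [rearrangement_iSup μ hu, ENNReal.iSup_mul]
  exact lintegral_iSup
    (fun n => (measurable_rearrangement μ (u n)).mul (measurable_rearrangement μ g))
    fun m n hmn t => mul_le_mul_left (rearrangement_mono (Eventually.of_forall (hu hmn)) t) _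

/-- The Hardy–Littlewood inequality. -/
theorem lintegral_mul_le_lintegral_rearrangement_mul [SFinite μ] (hf : AEMeasurable f μ)
    (hg : AEMeasurable g μ) :
    ∫⁻ x, f x * g x ∂μ ≤ ∫⁻ t, rearrangement μ f t * rearrangement μ g t ∂halfLine := by
  rw [lintegral_mul_eq_lintegral_lintegral_measure_inter hf hg, lintegral_rearrangement_mul]
  exact lintegral_mono fun s => lintegral_mono fun t =>
    le_min (measure_mono inter_subset_left) (measure_mono inter_subset_right)

theorem isResonant_iff : IsResonant μ ↔ ∀ f g : R → ℝ≥0∞, AEMeasurable f μ → AEMeasurable g μ →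
    (⨆ (h : R → ℝ≥0∞) (_ : AEMeasurable h μ) (_ : ∀ s, distribution μ h s = distribution μ g s),
      ∫⁻ x, f x * h x ∂μ) = ∫⁻ t, rearrangement μ f t * rearrangement μ g t ∂halfLine := by
  simp only [IsResonant, rearrangement_eq_iff]

/-- Since equimeasurable functions have the same rearrangement, the Hardy–Littlewood inequality
leaves only one inequality to check. -/
theorem isResonant_of_le [SFinite μ]
    (h : ∀ f g : R → ℝ≥0∞, AEMeasurable f μ → AEMeasurable g μ →
      ∫⁻ t, rearrangement μ f t * rearrangement μ g t ∂halfLine ≤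
        ⨆ (h : R → ℝ≥0∞) (_ : AEMeasurable h μ)
          (_ : ∀ s, distribution μ h s = distribution μ g s), ∫⁻ x, f x * h x ∂μ) :
    IsResonant μ := by
  refine isResonant_iff.2 fun f g hf hg =>
    le_antisymm (iSup₂_le fun h' hh' => iSup_le fun hhg => ?_) (h f g hf hg)
  have hrearr : rearrangement μ h' = rearrangement μ g := by
    funext t
    simp only [rearrangement, hhg]
  rw [← hrearr]
  exact lintegral_mul_le_lintegral_rearrangement_mul hf hh'

/-! ### Integrals of the rearrangement -/

/-- The functional `∫_0^m f^*`. For `m = 1` it is equivalent to the norm of `L¹ + L^∞` in its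
Wiener–Luxemburg form, see `sumNorm`. -/
noncomputable def rearrangementIntegral (μ : Measure R) (m : ℝ≥0∞) (f : R → ℝ≥0∞) : ℝ≥0∞ :=
  ∫⁻ t in {t | ENNReal.ofReal t < m}, rearrangement μ f t ∂halfLine

theorem measurableSet_setOf_ofReal_lt (m : ℝ≥0∞) : MeasurableSet {t | ENNReal.ofReal t < m} :=
  measurableSet_lt (by fun_prop) measurable_const

theorem rearrangementIntegral_eq_lintegral_min (μ : Measure R) (m : ℝ≥0∞) (f : R → ℝ≥0∞) :
    rearrangementIntegral μ m f =
      ∫⁻ s, min (distribution μ f s.toNNReal) m ∂halfLine := by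
  rw [rearrangementIntegral, setLIntegral_eq_lintegral_measure_inter
    (measurable_rearrangement μ f).aemeasurable
    (measurableSet_setOf_ofReal_lt m).nullMeasurableSet]
  refine lintegral_congr fun s => ?_
  simp only [ENNReal.ofReal, lt_rearrangement_iff, ← ofPred_and, ← lt_min_iff]
  exact halfLine_setOf_ofReal_lt _

theorem lintegral_rearrangement_mul_indicator_one (μ : Measure R) (f : R → ℝ≥0∞) (E : Set R) :
    ∫⁻ t, rearrangement μ f t * rearrangement μ (E.indicator fun _ => 1) t ∂halfLine =
      rearrangementIntegral μ (μ E) f := by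
  rw [rearrangementIntegral, ← lintegral_indicator (measurableSet_setOf_ofReal_lt _),
    rearrangement_indicator_one]
  refine lintegral_congr fun t => ?_
  simp only [indicator_apply, mul_ite, mul_one, mul_zero]

theorem setLIntegral_le_rearrangementIntegral [SFinite μ] (hf : AEMeasurable f μ) {E : Set R}
    (hE : NullMeasurableSet E μ) : ∫⁻ x in E, f x ∂μ ≤ rearrangementIntegral μ (μ E) f := by
  rw [setLIntegral_eq_lintegral_measure_inter hf hE, rearrangementIntegral_eq_lintegral_min]
  exact lintegral_mono fun s => le_min (measure_mono inter_subset_left)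
    (measure_mono inter_subset_right)

theorem rearrangementIntegral_le_max_one_mul (μ : Measure R) {m : ℝ≥0∞} (hm : m ≠ ∞)
    (f : R → ℝ≥0∞) :
    rearrangementIntegral μ m f ≤ max 1 m * rearrangementIntegral μ 1 f := by
  have hmax : max 1 m ≠ ∞ := max_ne_top ENNReal.one_ne_top hm
  rw [rearrangementIntegral_eq_lintegral_min, rearrangementIntegral_eq_lintegral_min,
    ← lintegral_const_mul' _ _ hmax]
  refine lintegral_mono fun s => ?_
  rw [mul_min, mul_one]
  exact min_le_min (le_mul_of_one_le_left' (le_max_left _ _)) (le_max_right _ _)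

theorem rearrangementIntegral_one_le (μ : Measure R) {m : ℝ≥0∞} (hm : min 1 (μ univ) ≤ m)
    (f : R → ℝ≥0∞) : rearrangementIntegral μ 1 f ≤ rearrangementIntegral μ m f := by
  rw [rearrangementIntegral_eq_lintegral_min, rearrangementIntegral_eq_lintegral_min]
  refine lintegral_mono fun s => le_min (min_le_left _ _) (le_trans ?_ hm)
  exact le_min (min_le_right _ _) ((min_le_left _ _).trans (measure_mono (subset_univ _)))

theorem rearrangement_le_rearrangementIntegral_one (μ : Measure R) (f : R → ℝ≥0∞) {t : ℝ}
    (ht : 1 ≤ t) : rearrangement μ f t ≤ rearrangementIntegral μ 1 f := by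
  calc rearrangement μ f t = ∫⁻ _ in {s | ENNReal.ofReal s < 1}, rearrangement μ f t ∂halfLine := by
        rw [setLIntegral_const, halfLine_setOf_ofReal_lt, mul_one]
    _ ≤ rearrangementIntegral μ 1 f :=
        setLIntegral_mono (measurable_rearrangement μ f) fun s hs =>
          rearrangement_antitone μ f ((ENNReal.ofReal_lt_one.1 hs).le.trans ht)

theorem rearrangementIntegral_indicator_one (μ : Measure R) (m : ℝ≥0∞) (E : Set R) :
    rearrangementIntegral μ m (E.indicator fun _ => 1) = min (μ E) m := by
  rw [rearrangementIntegral, rearrangement_indicator_one, setLIntegral_indicator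
    (measurableSet_setOf_ofReal_lt _), setLIntegral_one, ← ofPred_and]
  simp only [← lt_min_iff]
  exact halfLine_setOf_ofReal_lt _

/-- The norm `‖f^* χ_[0,1]‖_{L¹} + ‖f^* χ_(1,∞)‖_{L^∞}` of the space `L¹ + L^∞`. -/
noncomputable abbrev sumNorm (μ : Measure R) : (R → ℝ≥0∞) → ℝ≥0∞ :=
  wienerLuxemburg μ (lebesgueNorm halfLine 1) (lebesgueNorm halfLine ∞)

theorem lebesgueNorm_one (μ : Measure R) (f : R → ℝ≥0∞) :
    lebesgueNorm μ 1 f = ∫⁻ x, f x ∂μ := by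
  rw [lebesgueNorm, eLpNorm_one_eq_lintegral_enorm]
  simp only [enorm_eq_self]

theorem lebesgueNorm_one_indicator_rearrangement (μ : Measure R) (f : R → ℝ≥0∞) :
    lebesgueNorm halfLine 1 ((Icc 0 1).indicator (rearrangement μ f)) =
      rearrangementIntegral μ 1 f := by
  rw [lebesgueNorm_one, lintegral_indicator measurableSet_Icc]
  refine setLIntegral_congr (eventuallyEq_set.2 ?_)
  have hnonneg : ∀ᵐ t ∂halfLine, 0 ≤ t := ae_restrict_mem measurableSet_Ici
  filter_upwards [hnonneg, Measure.ae_ne halfLine 1] with t h0 h1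
  rw [mem_Icc, ENNReal.ofReal_lt_one]
  exact ⟨fun h => h.2.lt_of_ne h1, fun h => ⟨h0, h.le⟩⟩

theorem rearrangementIntegral_one_le_sumNorm (μ : Measure R) (f : R → ℝ≥0∞) :
    rearrangementIntegral μ 1 f ≤ sumNorm μ f :=
  (lebesgueNorm_one_indicator_rearrangement μ f).ge.trans le_self_add

theorem sumNorm_le_two_mul_rearrangementIntegral_one (μ : Measure R) (f : R → ℝ≥0∞) :
    sumNorm μ f ≤ 2 * rearrangementIntegral μ 1 f := by
  rw [two_mul]
  refine add_le_add (lebesgueNorm_one_indicator_rearrangement μ f).le ?_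
  rw [lebesgueNorm, eLpNorm_exponent_top, eLpNormEssSup]
  simp only [enorm_eq_self]
  refine essSup_le_of_ae_le _ (Eventually.of_forall fun t => ?_)
  exact indicator_le (fun t ht => rearrangement_le_rearrangementIntegral_one μ f (le_of_lt ht)) t

theorem exists_measurableSet_min_one_le (μ : Measure R) [SigmaFinite μ] :
    ∃ E, MeasurableSet E ∧ μ E < ∞ ∧ min 1 (μ univ) ≤ μ E := by
  by_cases h : μ univ = ∞
  · have hone : 1 < ⨆ n, μ (spanningSets μ n) := by
      rw [← (monotone_spanningSets μ).measure_iUnion, iUnion_spanningSets, h]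
      exact ENNReal.one_lt_top
    obtain ⟨n, hn⟩ := lt_iSup_iff.1 hone
    exact ⟨spanningSets μ n, measurableSet_spanningSets μ n, measure_spanningSets_lt_top μ n,
      (min_le_left _ _).trans hn.le⟩
  · exact ⟨univ, MeasurableSet.univ, lt_top_iff_ne_top.2 h, min_le_right _ _⟩

/-! ### Domination of functionals -/

/-- One half of the equivalence of functionals: `ρ ≤ C σ` for some constant `C > 0`. -/
def DominatedBy (μ : Measure R) (ρ σ : (R → ℝ≥0∞) → ℝ≥0∞) : Prop :=
  ∃ C : ℝ≥0, 0 < C ∧ ∀ f : R → ℝ≥0∞, AEMeasurable f μ → ρ f ≤ C * σ f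

variable {ρ σ τ : (R → ℝ≥0∞) → ℝ≥0∞}

theorem DominatedBy.of_le (h : ∀ f, AEMeasurable f μ → ρ f ≤ σ f) : DominatedBy μ ρ σ :=
  ⟨1, one_pos, fun f hf => by simpa using h f hf⟩

theorem DominatedBy.trans (h₁ : DominatedBy μ ρ σ) (h₂ : DominatedBy μ σ τ) :
    DominatedBy μ ρ τ := by
  obtain ⟨C, hC, h₁⟩ := h₁
  obtain ⟨D, hD, h₂⟩ := h₂
  refine ⟨C * D, mul_pos hC hD, fun f hf => ?_⟩
  calc ρ f ≤ C * σ f := h₁ f hf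
    _ ≤ C * (D * τ f) := by gcongr; exact h₂ f hf
    _ = (C * D : ℝ≥0) * τ f := by rw [ENNReal.coe_mul, mul_assoc]

theorem DominatedBy.max_left (h₁ : DominatedBy μ ρ τ) (h₂ : DominatedBy μ σ τ) :
    DominatedBy μ (fun f => max (ρ f) (σ f)) τ := by
  obtain ⟨C, hC, h₁⟩ := h₁
  obtain ⟨D, _, h₂⟩ := h₂
  refine ⟨max C D, lt_max_of_lt_left hC, fun f hf => max_le ((h₁ f hf).trans ?_)
    ((h₂ f hf).trans ?_)⟩
  · gcongr; exact le_max_left _ _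
  · gcongr; exact le_max_right _ _

theorem DominatedBy.equivalent (h₁ : DominatedBy μ ρ σ) (h₂ : DominatedBy μ σ ρ) :
    Equivalent μ ρ σ := by
  obtain ⟨C, hC, h₁⟩ := h₁
  obtain ⟨D, _, h₂⟩ := h₂
  refine ⟨max C D, lt_max_of_lt_left hC, fun f hf => ⟨(h₁ f hf).trans ?_, (h₂ f hf).trans ?_⟩⟩
  · gcongr; exact le_max_left _ _
  · gcongr; exact le_max_right _ _

theorem HasP5.of_dominatedBy (h : HasP5 μ ρ) (hd : DominatedBy μ ρ σ) : HasP5 μ σ := by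
  obtain ⟨D, _, hd⟩ := hd
  intro E hE hμE
  obtain ⟨C, hC⟩ := h E hE hμE
  refine ⟨C * D, fun f hf => ?_⟩
  calc ∫⁻ x in E, f x ∂μ ≤ C * ρ f := hC f hf
    _ ≤ C * (D * σ f) := by gcongr; exact hd f hf
    _ = (C * D : ℝ≥0) * σ f := by rw [ENNReal.coe_mul, mul_assoc]

/-! ### Associate functionals -/

theorem div_le_associateNorm (f : R → ℝ≥0∞) (hg : AEMeasurable g μ) (hρg : ρ g < ∞) :
    (∫⁻ x, f x * g x ∂μ) / ρ g ≤ associateNorm μ ρ f :=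
  le_iSup₂_of_le (f := fun g (_ : AEMeasurable g μ) =>
    ⨆ (_ : ρ g < ∞), (∫⁻ x, f x * g x ∂μ) / ρ g) g hg (le_iSup_of_le hρg le_rfl)

theorem associateNorm_le {c : ℝ≥0∞}
    (h : ∀ g, AEMeasurable g μ → ρ g < ∞ → (∫⁻ x, f x * g x ∂μ) / ρ g ≤ c) :
    associateNorm μ ρ f ≤ c :=
  iSup₂_le fun g hg => iSup_le fun hρg => h g hg hρg

theorem lintegral_mul_le_associateNorm_mul (f : R → ℝ≥0∞) (hg : AEMeasurable g μ)
    (h0 : ρ g = 0 → ∀ᵐ x ∂μ, g x = 0) (hρg : ρ g < ∞) :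
    ∫⁻ x, f x * g x ∂μ ≤ associateNorm μ ρ f * ρ g := by
  by_cases hz : ρ g = 0
  · have : ∫⁻ x, f x * g x ∂μ = 0 := by
      rw [lintegral_congr_ae ((h0 hz).mono fun x hx => congrArg (f x * ·) hx)]
      simp
    exact this.le.trans zero_le
  · exact (ENNReal.div_le_iff hz hρg.ne).1 (div_le_associateNorm f hg hρg)

theorem lintegral_mul_indicator_one (μ : Measure R) (f : R → ℝ≥0∞) {E : Set R}
    (hE : MeasurableSet E) :
    ∫⁻ x, f x * E.indicator (fun _ => 1) x ∂μ = ∫⁻ x in E, f x ∂μ := by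
  rw [← lintegral_indicator hE]
  refine lintegral_congr fun x => ?_
  by_cases hx : x ∈ E <;> simp [hx]

theorem setLIntegral_le_associateNorm_mul (f : R → ℝ≥0∞) {E : Set R} (hE : MeasurableSet E)
    (h0 : ρ (E.indicator fun _ => 1) = 0 → μ E = 0) (hρE : ρ (E.indicator fun _ => 1) < ∞) :
    ∫⁻ x in E, f x ∂μ ≤ associateNorm μ ρ f * ρ (E.indicator fun _ => 1) := by
  rw [← lintegral_mul_indicator_one μ f hE]
  refine lintegral_mul_le_associateNorm_mul f (measurable_const.indicator hE).aemeasurable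
    (fun hz => ?_) hρE
  filter_upwards [measure_eq_zero_iff_ae_notMem.1 (h0 hz)] with x hx
  exact indicator_of_notMem hx _

theorem associateNorm_mono (h : ∀ᵐ x ∂μ, f x ≤ g x) :
    associateNorm μ ρ f ≤ associateNorm μ ρ g := by
  refine associateNorm_le fun k hk hρk => le_trans ?_ (div_le_associateNorm g hk hρk)
  gcongr ?_ / _
  exact lintegral_mono_ae (h.mono fun x hx => by gcongr)

theorem associateNorm_eq_zero (h : ∀ᵐ x ∂μ, f x = 0) : associateNorm μ ρ f = 0 := by
  refine le_antisymm (associateNorm_le fun g _ _ => ?_) zero_le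
  rw [lintegral_congr_ae (h.mono fun x hx => congrArg (· * g x) hx)]
  simp

theorem associateNorm_homogeneous (a : ℝ≥0) (f : R → ℝ≥0∞) :
    associateNorm μ ρ (fun x => a * f x) = a * associateNorm μ ρ f := by
  simp only [associateNorm, mul_assoc, lintegral_const_mul' _ _ (ENNReal.coe_ne_top (r := a)),
    mul_div_assoc, ENNReal.mul_iSup]

theorem associateNorm_subadditive (hf : AEMeasurable f μ) :
    associateNorm μ ρ (fun x => f x + g x) ≤ associateNorm μ ρ f + associateNorm μ ρ g := by
  refine associateNorm_le fun h hh hρh => ?_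
  simp only [add_mul]
  rw [lintegral_add_left' (by fun_prop), ENNReal.add_div]
  exact add_le_add (div_le_associateNorm f hh hρh) (div_le_associateNorm g hh hρh)

theorem associateNorm_hasP3 : HasP3 μ (associateNorm μ ρ) := by
  intro u f hu _ h
  have hmono : Monotone fun n => associateNorm μ ρ (u n) := fun m n hmn =>
    associateNorm_mono (h.mono fun x hx => hx.1 hmn)
  suffices associateNorm μ ρ f = ⨆ n, associateNorm μ ρ (u n) from
    ⟨hmono, this ▸ tendsto_atTop_iSup hmono⟩
  refine le_antisymm (associateNorm_le fun g hg hρg => ?_) (iSup_le fun n =>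
    associateNorm_mono (h.mono fun x hx => hx.1.ge_of_tendsto hx.2 n))
  have hsup : ∫⁻ x, f x * g x ∂μ = ⨆ n, ∫⁻ x, u n x * g x ∂μ := by
    rw [← lintegral_iSup' (by fun_prop) (h.mono fun x hx m n hmn => by
      exact mul_le_mul_left (hx.1 hmn) (g x))]
    refine lintegral_congr_ae (h.mono fun x hx => ?_)
    simp only [← ENNReal.iSup_mul, iSup_eq_of_tendsto hx.1 hx.2]
  rw [hsup, ENNReal.iSup_div]
  exact iSup_mono fun n => div_le_associateNorm (u n) hg hρg

theorem HasP5.eq_zero [SigmaFinite μ] (h : HasP5 μ ρ) (hf : AEMeasurable f μ) (h0 : ρ f = 0) :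
    ∀ᵐ x ∂μ, f x = 0 := by
  have hspan : ∀ n, ∀ᵐ x ∂μ.restrict (spanningSets μ n), f x = 0 := fun n => by
    obtain ⟨C, hC⟩ := h _ (measurableSet_spanningSets μ n) (measure_spanningSets_lt_top μ n)
    have hint := hC f hf
    rwa [h0, mul_zero, nonpos_iff_eq_zero, lintegral_eq_zero_iff' hf.restrict] at hint
  rwa [← ae_restrict_iUnion_iff, iUnion_spanningSets, Measure.restrict_univ] at hspan

theorem HasP5.eq_zero_of_indicator [SigmaFinite μ] (h : HasP5 μ ρ) {E : Set R}
    (hE : MeasurableSet E) (h0 : ρ (E.indicator fun _ => 1) = 0) : μ E = 0 := by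
  have hχ := h.eq_zero (measurable_const.indicator hE).aemeasurable h0
  refine measure_eq_zero_iff_ae_notMem.2 (hχ.mono fun x hx hxE => one_ne_zero (α := ℝ≥0∞) ?_)
  rwa [indicator_of_mem hxE] at hx

theorem associateNorm_hasP4 (h : HasP5 μ ρ) : HasP4 μ (associateNorm μ ρ) := by
  intro E hE hμE
  obtain ⟨C, hC⟩ := h E hE hμE
  refine lt_of_le_of_lt (associateNorm_le (c := C) fun g hg _ => ?_) ENNReal.coe_lt_top
  simp only [mul_comm (E.indicator _ _)]
  rw [lintegral_mul_indicator_one μ g hE]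
  exact ENNReal.div_le_of_le_mul (hC g hg)

theorem associateNorm_hasP5 [SigmaFinite μ] (h4 : HasP4 μ ρ) (h5 : HasP5 μ ρ) :
    HasP5 μ (associateNorm μ ρ) := by
  intro E hE hμE
  have hρE := h4 E hE hμE
  refine ⟨(ρ (E.indicator fun _ => 1)).toNNReal, fun f _ => ?_⟩
  rw [ENNReal.coe_toNNReal hρE.ne, mul_comm]
  exact setLIntegral_le_associateNorm_mul f hE (h5.eq_zero_of_indicator hE) hρE

theorem associateNorm_isBanachFunctionNorm [SigmaFinite μ] (h4 : HasP4 μ ρ) (h5 : HasP5 μ ρ) :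
    IsBanachFunctionNorm μ (associateNorm μ ρ) where
  p1 := ⟨fun a f _ => associateNorm_homogeneous a f,
    fun _ hf => ⟨(associateNorm_hasP5 h4 h5).eq_zero hf, associateNorm_eq_zero⟩,
    fun _ _ hf _ => associateNorm_subadditive hf⟩
  p2 := fun _ _ _ _ h => associateNorm_mono h
  p3 := associateNorm_hasP3
  p4 := associateNorm_hasP4 h5
  p5 := associateNorm_hasP5 h4 h5

theorem associateNorm_associateNorm_le (h0 : ∀ f, AEMeasurable f μ → ρ f = 0 → ∀ᵐ x ∂μ, f x = 0)
    (hf : AEMeasurable f μ) : associateNorm μ (associateNorm μ ρ) f ≤ ρ f := by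
  rcases eq_or_ne (ρ f) ∞ with h | h
  · simp only [h, le_top]
  refine associateNorm_le fun g _ _ => ENNReal.div_le_of_le_mul ?_
  simp only [mul_comm (f _)]
  rw [mul_comm]
  exact lintegral_mul_le_associateNorm_mul g hf (h0 f hf) h.lt_top

theorem DominatedBy.associateNorm (h : DominatedBy μ ρ σ) :
    DominatedBy μ (associateNorm μ σ) (associateNorm μ ρ) := by
  obtain ⟨C, hC, h⟩ := h
  refine ⟨C, hC, fun f _ => associateNorm_le fun g hg hσg => ?_⟩
  have hρg : ρ g < ∞ := (h g hg).trans_lt (ENNReal.mul_lt_top ENNReal.coe_lt_top hσg)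
  calc (∫⁻ x, f x * g x ∂μ) / σ g ≤ (∫⁻ x, f x * g x ∂μ) / (ρ g / C) :=
        ENNReal.div_le_div_left (ENNReal.div_le_of_le_mul' (h g hg)) _
    _ = C * ((∫⁻ x, f x * g x ∂μ) / ρ g) := by
        rw [div_eq_mul_inv, div_eq_mul_inv, div_eq_mul_inv, ENNReal.mul_inv
          (Or.inr (by simpa using hC.ne')) (Or.inr (by simp)), inv_inv]
        ring
    _ ≤ C * RIFunctionSpace.associateNorm μ ρ f := by
        gcongr
        exact div_le_associateNorm f hg hρg

theorem IsRearrangementInvariant.associateNorm [SFinite μ] (hri : IsRearrangementInvariant μ ρ)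
    (hμ : IsResonant μ) : IsRearrangementInvariant μ (associateNorm μ ρ) := by
  suffices key : ∀ f g : R → ℝ≥0∞, AEMeasurable f μ → AEMeasurable g μ →
      (∀ s, distribution μ f s = distribution μ g s) →
      RIFunctionSpace.associateNorm μ ρ f ≤ RIFunctionSpace.associateNorm μ ρ g from
    fun f g hf hg hfg => (key f g hf hg hfg).antisymm (key g f hg hf fun s => (hfg s).symm)
  intro f g hf hg hfg
  refine associateNorm_le fun k hk hρk => ?_
  have hrearr : rearrangement μ f = rearrangement μ g := by
    funext t
    simp only [rearrangement, hfg]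
  have hle : ∫⁻ x, f x * k x ∂μ ≤ ⨆ (h : R → ℝ≥0∞) (_ : AEMeasurable h μ)
      (_ : ∀ s, distribution μ h s = distribution μ k s), ∫⁻ x, g x * h x ∂μ := by
    rw [isResonant_iff.1 hμ g k hg hk, ← hrearr]
    exact lintegral_mul_le_lintegral_rearrangement_mul hf hk
  refine (ENNReal.div_le_div_right hle _).trans ?_
  simp only [ENNReal.iSup_div]
  refine iSup₂_le fun h hh => iSup_le fun hhk => ?_
  have hρ := hri h k hh hk hhk
  exact hρ ▸ div_le_associateNorm g hh (hρ ▸ hρk)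

theorem ae_restrict_le_mul_associateNorm [SigmaFinite μ] (hf : AEMeasurable f μ) {S : Set R}
    (hS : MeasurableSet S) {C : ℝ≥0}
    (h0 : ∀ E, MeasurableSet E → ρ (E.indicator fun _ => 1) = 0 → μ E = 0)
    (hC : ∀ E ⊆ S, MeasurableSet E → ρ (E.indicator fun _ => 1) ≤ C * μ E) :
    ∀ᵐ x ∂μ.restrict S, f x ≤ C * associateNorm μ ρ f := by
  refine ae_le_of_forall_setLIntegral_le_of_sigmaFinite₀ hf.restrict fun E hE hμE => ?_
  have hES : MeasurableSet (E ∩ S) := hE.inter hS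
  rw [Measure.restrict_apply hE] at hμE
  have hle := hC (E ∩ S) inter_subset_right hES
  have hρ : ρ ((E ∩ S).indicator fun _ => 1) < ∞ :=
    hle.trans_lt (ENNReal.mul_lt_top ENNReal.coe_lt_top hμE)
  rw [Measure.restrict_restrict hE, setLIntegral_const]
  calc ∫⁻ x in E ∩ S, f x ∂μ
      ≤ RIFunctionSpace.associateNorm μ ρ f * ρ ((E ∩ S).indicator fun _ => 1) :=
        setLIntegral_le_associateNorm_mul f hES (h0 _ hES) hρ
    _ ≤ RIFunctionSpace.associateNorm μ ρ f * (C * μ (E ∩ S)) := by gcongr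
    _ = C * RIFunctionSpace.associateNorm μ ρ f * μ (E ∩ S) := by ring

/-! ### The Lorentz–Luxemburg theorem -/

theorem HasP2.congr (h : HasP2 μ ρ) (hf : AEMeasurable f μ) (hg : AEMeasurable g μ)
    (hfg : ∀ᵐ x ∂μ, f x = g x) : ρ f = ρ g :=
  le_antisymm (h f g hf hg (hfg.mono fun _ hx => hx.le))
    (h g f hg hf (hfg.mono fun _ hx => hx.ge))

theorem HasP3.le_of_tendsto (h3 : HasP3 μ ρ) (h2 : HasP2 μ ρ) {u : ℕ → R → ℝ≥0∞}
    (hu : ∀ n, AEMeasurable (u n) μ) (hf : AEMeasurable f μ)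
    (hlim : ∀ᵐ x ∂μ, Tendsto (fun n => u n x) atTop (𝓝 (f x))) {c : ℝ≥0∞}
    (hc : ∀ n, ρ (u n) ≤ c) : ρ f ≤ c := by
  have hmeas : ∀ n, AEMeasurable (fun x => ⨅ k, u (k + n) x) μ := fun n =>
    AEMeasurable.iInf fun k => hu (k + n)
  refine le_of_tendsto' (h3 (fun n x => ⨅ k, u (k + n) x) f hmeas hf ?_).2 fun n =>
    (h2 _ _ (hmeas n) (hu (0 + n)) (Eventually.of_forall fun x => iInf_le _ 0)).trans (hc _)
  filter_upwards [hlim] with x hx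
  have hmono : Monotone fun n => ⨅ k, u (k + n) x := fun m n hmn =>
    le_iInf fun k => iInf_le_of_le (k + (n - m)) (by rw [add_assoc, Nat.sub_add_cancel hmn])
  refine ⟨hmono, ?_⟩
  rw [← hx.liminf_eq, liminf_eq_iSup_iInf_of_nat']
  exact tendsto_atTop_iSup hmono

/-- The truncation of `f` in height at `n` and in support to the `n`-th spanning set. -/
noncomputable def truncation (μ : Measure R) [SigmaFinite μ] (f : R → ℝ≥0∞) (n : ℕ) :
    R → ℝ≥0∞ :=
  (spanningSets μ n).indicator fun x => min (f x) n

theorem monotone_truncation [SigmaFinite μ] (x : R) : Monotone fun n => truncation μ f n x := by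
  intro m n hmn
  refine le_trans (indicator_le_indicator_of_subset (monotone_spanningSets μ hmn)
    (fun _ => zero_le) x) (indicator_le_indicator ?_)
  gcongr

theorem tendsto_truncation [SigmaFinite μ] (x : R) :
    Tendsto (fun n => truncation μ f n x) atTop (𝓝 (f x)) := by
  have hmin : Tendsto (fun n : ℕ => min (f x) n) atTop (𝓝 (min (f x) ∞)) :=
    tendsto_const_nhds.min ENNReal.tendsto_nat_nhds_top
  rw [min_eq_left le_top] at hmin
  refine hmin.congr' ?_
  obtain ⟨N, hN⟩ := mem_iUnion.1 ((iUnion_spanningSets μ).ge (mem_univ x))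
  filter_upwards [eventually_ge_atTop N] with n hn
  rw [truncation, indicator_of_mem (monotone_spanningSets μ hn hN)]

theorem truncation_le_indicator [SigmaFinite μ] (n : ℕ) (x : R) :
    truncation μ f n x ≤ (spanningSets μ n).indicator (fun _ => (n : ℝ≥0∞)) x :=
  indicator_le_indicator (min_le_right _ _)

theorem truncation_ne_top [SigmaFinite μ] (n : ℕ) (x : R) : truncation μ f n x ≠ ∞ :=
  ((truncation_le_indicator n x).trans_lt ((indicator_le_self _ _ x).trans_lt
    (ENNReal.natCast_lt_top n))).ne

theorem memLp_toReal_truncation [SigmaFinite μ] (p : ℝ≥0∞) (hf : AEMeasurable f μ) (n : ℕ) :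
    MemLp (fun x => (truncation μ f n x).toReal) p μ := by
  have hmeas : AEMeasurable (truncation μ f n) μ :=
    (hf.min aemeasurable_const).indicator (measurableSet_spanningSets μ n)
  refine (memLp_indicator_const p (measurableSet_spanningSets μ n) (n : ℝ)
    (Or.inr (measure_spanningSets_lt_top μ n).ne)).mono
    hmeas.ennreal_toReal.aestronglyMeasurable (Eventually.of_forall fun x => ?_)
  rw [Real.norm_of_nonneg ENNReal.toReal_nonneg, norm_indicator_eq_indicator_norm]
  refine ENNReal.toReal_le_of_le_ofReal (indicator_nonneg (fun _ _ => norm_nonneg _) x)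
    ((truncation_le_indicator n x).trans ?_)
  by_cases hx : x ∈ spanningSets μ n <;> simp [hx]

theorem exists_seq_Lp_enorm_tendsto [SigmaFinite μ] (p : ℝ≥0∞) (hf : AEMeasurable f μ) :
    ∃ v : ℕ → Lp ℝ p μ, ∀ᵐ x ∂μ, Monotone (fun n => ‖v n x‖ₑ) ∧
      Tendsto (fun n => ‖v n x‖ₑ) atTop (𝓝 (f x)) := by
  refine ⟨fun n => (memLp_toReal_truncation p hf n).toLp, ?_⟩
  filter_upwards [ae_all_iff.2 fun n => (memLp_toReal_truncation p hf n).coeFn_toLp] with x hx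
  have heq (n : ℕ) : ‖(memLp_toReal_truncation p hf n).toLp _ x‖ₑ = truncation μ f n x := by
    rw [hx, Real.enorm_of_nonneg ENNReal.toReal_nonneg,
      ENNReal.ofReal_toReal (truncation_ne_top n x)]
  simp only [heq]
  exact ⟨monotone_truncation x, tendsto_truncation x⟩

/-- The elements of `L^p` in the ball of radius `r` of the functional `ρ`; by the Fatou property it
is closed in `L^p`, even though `ρ` is not continuous there. -/
def lpBall (μ : Measure R) (p : ℝ≥0∞) (ρ : (R → ℝ≥0∞) → ℝ≥0∞) (r : ℝ≥0) : Set (Lp ℝ p μ) :=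
  {h | ρ (fun x => ‖h x‖ₑ) ≤ r}

theorem aemeasurable_enorm_Lp {p : ℝ≥0∞} (h : Lp ℝ p μ) : AEMeasurable (fun x => ‖h x‖ₑ) μ :=
  (Lp.aestronglyMeasurable h).enorm

theorem convex_lpBall {p : ℝ≥0∞} (h1 : HasP1 μ ρ) (h2 : HasP2 μ ρ) (r : ℝ≥0) :
    Convex ℝ (lpBall μ p ρ r) := by
  intro f hf g hg a b ha hb hab
  lift a to ℝ≥0 using ha
  lift b to ℝ≥0 using hb
  have hf' := aemeasurable_enorm_Lp f
  have hg' := aemeasurable_enorm_Lp g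
  have hpt : ∀ᵐ x ∂μ, ‖((a : ℝ) • f + (b : ℝ) • g) x‖ₑ ≤ a * ‖f x‖ₑ + b * ‖g x‖ₑ := by
    filter_upwards [Lp.coeFn_add ((a : ℝ) • f) ((b : ℝ) • g), Lp.coeFn_smul (a : ℝ) f,
      Lp.coeFn_smul (b : ℝ) g] with x hadd haf hbg
    rw [hadd, Pi.add_apply, haf, hbg, Pi.smul_apply, Pi.smul_apply]
    refine (enorm_add_le _ _).trans_eq ?_
    simp only [enorm_smul, Real.enorm_of_nonneg (NNReal.coe_nonneg _), ENNReal.ofReal_coe_nnreal]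
  calc ρ (fun x => ‖((a : ℝ) • f + (b : ℝ) • g) x‖ₑ)
      ≤ ρ (fun x => a * ‖f x‖ₑ + b * ‖g x‖ₑ) :=
        h2 _ _ (aemeasurable_enorm_Lp _) (by fun_prop) hpt
    _ ≤ ρ (fun x => a * ‖f x‖ₑ) + ρ (fun x => b * ‖g x‖ₑ) :=
        h1.subadditive _ _ (by fun_prop) (by fun_prop)
    _ ≤ a * r + b * r := by
        rw [h1.homogeneous a _ hf', h1.homogeneous b _ hg']
        exact add_le_add (mul_le_mul_right hf _) (mul_le_mul_right hg _)
    _ = r := by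
        rw [← add_mul, ← ENNReal.coe_add, show a + b = 1 by exact_mod_cast hab, ENNReal.coe_one,
          one_mul]

theorem isClosed_lpBall {p : ℝ≥0∞} [Fact (1 ≤ p)] (h2 : HasP2 μ ρ) (h3 : HasP3 μ ρ) (r : ℝ≥0) :
    IsClosed (lpBall μ p ρ r) := by
  refine isSeqClosed_iff_isClosed.1 fun u f hu hlim => ?_
  obtain ⟨ns, -, hns⟩ := (tendstoInMeasure_of_tendsto_Lp hlim).exists_seq_tendsto_ae
  exact h3.le_of_tendsto h2 (fun n => aemeasurable_enorm_Lp (u (ns n)))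
    (aemeasurable_enorm_Lp f) (hns.mono fun x hx => hx.enorm) fun n => hu (ns n)

theorem exists_inner_lt_of_notMem {H : Type*} [NormedAddCommGroup H] [InnerProductSpace ℝ H]
    [CompleteSpace H] {s : Set H} (hs : Convex ℝ s) (hc : IsClosed s) {v : H} (hv : v ∉ s) :
    ∃ (k : H) (u : ℝ), (∀ h ∈ s, inner ℝ k h < u) ∧ u < inner ℝ k v := by
  obtain ⟨φ, u, hφ, hu⟩ := geometric_hahn_banach_closed_point hs hc hv
  obtain ⟨k, rfl⟩ := (InnerProductSpace.toDual ℝ H).surjective φ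
  exact ⟨k, u, hφ, hu⟩

theorem ofReal_inner_le_lintegral (k v : Lp ℝ 2 μ) :
    ENNReal.ofReal (inner ℝ k v) ≤ ∫⁻ x, ‖v x‖ₑ * ‖k x‖ₑ ∂μ := by
  calc ENNReal.ofReal (inner ℝ k v) ≤ ‖inner ℝ k v‖ₑ := Real.ofReal_le_enorm _
    _ ≤ ∫⁻ x, ‖inner ℝ (k x) (v x)‖ₑ ∂μ := by
        rw [L2.inner_def]
        exact enorm_integral_le_lintegral_enorm _
    _ = ∫⁻ x, ‖v x‖ₑ * ‖k x‖ₑ ∂μ := by simp only [RCLike.inner_apply, conj_trivial, enorm_mul]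

theorem exists_enorm_eq_lintegral_eq_ofReal_inner (k v : Lp ℝ 2 μ) :
    ∃ h : Lp ℝ 2 μ, (∀ᵐ x ∂μ, ‖h x‖ₑ = ‖v x‖ₑ) ∧
      ∫⁻ x, ‖v x‖ₑ * ‖k x‖ₑ ∂μ = ENNReal.ofReal (inner ℝ k h) := by
  classical
  have hA : MeasurableSet {x | 0 ≤ v x * k x} := measurableSet_le measurable_const
    ((Lp.stronglyMeasurable v).measurable.mul (Lp.stronglyMeasurable k).measurable)
  let s : R → ℝ := {x | 0 ≤ v x * k x}.piecewise v (-v)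
  have hnorm (x : R) : ‖s x‖ = ‖v x‖ := by
    by_cases hx : x ∈ {x | 0 ≤ v x * k x} <;> simp [s, hx]
  have hs : MemLp s 2 μ := (Lp.memLp v).congr_norm
    ((Lp.stronglyMeasurable v).piecewise hA (Lp.stronglyMeasurable v).neg).aestronglyMeasurable
    (Eventually.of_forall fun x => (hnorm x).symm)
  have habs (x : R) : s x * k x = ‖v x * k x‖ := by
    by_cases hx : x ∈ {x | 0 ≤ v x * k x}
    · simp only [s, piecewise_eq_of_mem _ _ _ hx, Real.norm_of_nonneg hx]
    · simp only [s, piecewise_eq_of_notMem _ _ _ hx, Real.norm_of_nonpos (not_le.1 hx).le,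
        Pi.neg_apply, neg_mul]
  refine ⟨hs.toLp, hs.coeFn_toLp.mono fun x hx => ?_, ?_⟩
  · rw [hx, ← ofReal_norm, ← ofReal_norm, hnorm]
  · have hinner : inner ℝ k (hs.toLp s) = ∫ x, ‖v x * k x‖ ∂μ := by
      rw [L2.inner_def]
      refine integral_congr_ae (hs.coeFn_toLp.mono fun x hx => ?_)
      simp only [hx, RCLike.inner_apply, conj_trivial, habs]
    have hint : Integrable (fun x => v x * k x) μ := (Lp.memLp v).integrable_mul (Lp.memLp k)
    rw [hinner, ofReal_integral_norm_eq_lintegral_enorm hint]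
    simp only [enorm_mul]

theorem lintegral_mul_enorm_le_of_inner_le [SigmaFinite μ] (h2 : HasP2 μ ρ) {r : ℝ≥0}
    {k : Lp ℝ 2 μ} {u : ℝ} (hu : ∀ h ∈ lpBall μ 2 ρ r, inner ℝ k h ≤ u) (hf : AEMeasurable f μ)
    (hfr : ρ f ≤ r) : ∫⁻ x, f x * ‖k x‖ₑ ∂μ ≤ ENNReal.ofReal u := by
  obtain ⟨v, hv⟩ := exists_seq_Lp_enorm_tendsto 2 hf
  have hlim : Tendsto (fun n => ∫⁻ x, ‖v n x‖ₑ * ‖k x‖ₑ ∂μ) atTop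
      (𝓝 (∫⁻ x, f x * ‖k x‖ₑ ∂μ)) :=
    lintegral_tendsto_of_tendsto_of_monotone
      (fun n => (aemeasurable_enorm_Lp (v n)).mul (aemeasurable_enorm_Lp k))
      (hv.mono fun x hx m n hmn => mul_le_mul_left (hx.1 hmn) _)
      (hv.mono fun x hx => ENNReal.Tendsto.mul_const hx.2 (Or.inr enorm_ne_top))
  refine le_of_tendsto' hlim fun n => ?_
  obtain ⟨h, hhv, hh⟩ := exists_enorm_eq_lintegral_eq_ofReal_inner k (v n)
  have hmem : ρ (fun x => ‖h x‖ₑ) ≤ r := by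
    refine (h2 _ _ (aemeasurable_enorm_Lp h) hf ?_).trans hfr
    filter_upwards [hhv, hv] with x hx hvx
    exact hx.le.trans (hvx.1.ge_of_tendsto hvx.2 n)
  exact hh.le.trans (ENNReal.ofReal_le_ofReal (hu h hmem))

theorem HasP1.associateNorm_le_div (h1 : HasP1 μ ρ) {r : ℝ≥0} (hr : 0 < r) {u : ℝ≥0∞}
    (h : ∀ g, AEMeasurable g μ → ρ g ≤ r → ∫⁻ x, g x * f x ∂μ ≤ u) :
    associateNorm μ ρ f ≤ u / r := by
  refine associateNorm_le fun g hg hρg => ?_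
  simp only [mul_comm (f _)]
  rcases eq_or_ne (ρ g) 0 with hz | hz
  · rw [lintegral_congr_ae (((h1.eq_zero_iff g hg).1 hz).mono fun x hx => congrArg (· * f x) hx)]
    simp
  obtain ⟨c, hc⟩ : ∃ c : ℝ≥0, c = ρ g := ⟨_, ENNReal.coe_toNNReal hρg.ne⟩
  have hc0 : c ≠ 0 := by rintro rfl; exact hz hc.symm
  have hscale : ∫⁻ x, (r / c : ℝ≥0) * g x * f x ∂μ ≤ u := h _ (by fun_prop) (by
    rw [h1.homogeneous _ _ hg, ← hc, ← ENNReal.coe_mul, div_mul_cancel₀ _ hc0])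
  simp only [mul_assoc, lintegral_const_mul' _ _ ENNReal.coe_ne_top] at hscale
  rw [ENNReal.le_div_iff_mul_le (Or.inl (by exact_mod_cast hr.ne')) (Or.inl ENNReal.coe_ne_top)]
  refine le_trans (le_of_eq ?_) hscale
  rw [← hc, ENNReal.coe_div hc0, div_eq_mul_inv, div_eq_mul_inv]
  ring

theorem le_associateNorm_associateNorm_enorm_Lp [SigmaFinite μ] (h1 : HasP1 μ ρ)
    (h2 : HasP2 μ ρ) (h3 : HasP3 μ ρ) (v : Lp ℝ 2 μ) :
    ρ (fun x => ‖v x‖ₑ) ≤ associateNorm μ (associateNorm μ ρ) fun x => ‖v x‖ₑ := by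
  by_contra! hlt
  obtain ⟨r, hr, hrv⟩ := ENNReal.lt_iff_exists_nnreal_btwn.1 hlt
  have hr0 : 0 < r := by exact_mod_cast zero_le.trans_lt hr
  have hv : v ∉ lpBall μ 2 ρ r := hrv.not_ge
  obtain ⟨k, u, hku, huv⟩ := exists_inner_lt_of_notMem (s := lpBall μ 2 ρ r)
    (convex_lpBall h1 h2 r) (isClosed_lpBall h2 h3 r) hv
  have hzero : (0 : Lp ℝ 2 μ) ∈ lpBall μ 2 ρ r :=
    ((h1.eq_zero_iff _ (aemeasurable_enorm_Lp _)).2 ((Lp.coeFn_zero ℝ 2 μ).mono fun x hx => by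
      rw [hx, Pi.zero_apply, enorm_zero])).le.trans zero_le
  have hu0 : 0 < u := by simpa using hku 0 hzero
  have hk : associateNorm μ ρ (fun x => ‖k x‖ₑ) ≤ ENNReal.ofReal u / r :=
    h1.associateNorm_le_div hr0 fun g hg hgr =>
      lintegral_mul_enorm_le_of_inner_le h2 (fun h hh => (hku h hh).le) hg hgr
  refine hr.not_ge ?_
  calc (r : ℝ≥0∞) = ENNReal.ofReal u / (ENNReal.ofReal u / r) :=
        (ENNReal.div_div_cancel (ENNReal.ofReal_pos.2 hu0).ne' ENNReal.ofReal_ne_top).symm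
    _ ≤ (∫⁻ x, ‖v x‖ₑ * ‖k x‖ₑ ∂μ) / associateNorm μ ρ (fun x => ‖k x‖ₑ) :=
        ENNReal.div_le_div ((ENNReal.ofReal_le_ofReal huv.le).trans
          (ofReal_inner_le_lintegral k v)) hk
    _ ≤ associateNorm μ (associateNorm μ ρ) fun x => ‖v x‖ₑ :=
        div_le_associateNorm _ (aemeasurable_enorm_Lp k)
          (hk.trans_lt (ENNReal.div_lt_top ENNReal.ofReal_ne_top (by exact_mod_cast hr0.ne')))

theorem le_associateNorm_associateNorm [SigmaFinite μ] (h1 : HasP1 μ ρ) (h2 : HasP2 μ ρ)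
    (h3 : HasP3 μ ρ) (hf : AEMeasurable f μ) :
    ρ f ≤ associateNorm μ (associateNorm μ ρ) f := by
  obtain ⟨v, hv⟩ := exists_seq_Lp_enorm_tendsto 2 hf
  refine le_of_tendsto' (h3 _ f (fun n => aemeasurable_enorm_Lp (v n)) hf hv).2 fun n => ?_
  exact (le_associateNorm_associateNorm_enorm_Lp h1 h2 h3 (v n)).trans
    (associateNorm_mono (hv.mono fun x hx => hx.1.ge_of_tendsto hx.2 n))

/-! ### Embeddings -/

theorem HasP1.hasQ1 (h : HasP1 μ ρ) : HasQ1 μ ρ :=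
  ⟨h.homogeneous, h.eq_zero_iff, 1, le_rfl, fun f g hf hg => by
    simpa using h.subadditive f g hf hg⟩

theorem aemeasurable_enorm_aeeqFun (F : R →ₘ[μ] ℂ) : AEMeasurable (fun x => ‖F x‖ₑ) μ :=
  F.aestronglyMeasurable.enorm

theorem DominatedBy.space_subset (h : DominatedBy μ σ ρ) : space μ ρ ⊆ space μ σ := by
  obtain ⟨C, _, h⟩ := h
  exact fun F hF => (h _ (aemeasurable_enorm_aeeqFun F)).trans_lt
    (ENNReal.mul_lt_top ENNReal.coe_lt_top hF)

theorem DominatedBy.embeds (h : DominatedBy μ σ ρ) : Embeds μ ρ σ := by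
  refine ⟨h.space_subset, fun u F _ _ hlim => ?_⟩
  obtain ⟨C, _, h⟩ := h
  have hC := ENNReal.Tendsto.const_mul hlim (Or.inr (ENNReal.coe_ne_top (r := C)))
  rw [mul_zero] at hC
  exact tendsto_of_tendsto_of_tendsto_of_le_of_le tendsto_const_nhds hC (fun _ => zero_le)
    fun n => h _ (aemeasurable_enorm_aeeqFun (u n - F))

theorem ae_lt_top_of_lt_top (h1 : HasQ1 μ ρ) (h2 : HasP2 μ ρ) (hf : AEMeasurable f μ)
    (hρf : ρ f < ∞) : ∀ᵐ x ∂μ, f x < ∞ := by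
  let χ : R → ℝ≥0∞ := ({∞} : Set ℝ≥0∞).indicator 1 ∘ f
  have hχ : AEMeasurable χ μ :=
    (measurable_one.indicator (measurableSet_singleton ∞)).comp_aemeasurable hf
  have hle (n : ℕ) : n * ρ χ ≤ ρ f := by
    rw [← ENNReal.coe_natCast, ← h1.homogeneous n χ hχ]
    refine h2 _ _ (by fun_prop) hf (Eventually.of_forall fun x => ?_)
    by_cases hx : f x = ∞ <;> simp [χ, hx]
  have hz : ρ χ = 0 := by
    by_contra hne
    obtain ⟨n, hn⟩ := ENNReal.exists_nat_mul_gt hne hρf.ne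
    exact (hle n).not_gt hn
  filter_upwards [(h1.eq_zero_iff χ hχ).1 hz] with x hx
  refine lt_top_iff_ne_top.2 fun htop => ?_
  simp [χ, htop] at hx

theorem exists_aeeqFun_enorm_eq (hf : AEMeasurable f μ) (hfin : ∀ᵐ x ∂μ, f x < ∞) :
    ∃ F : R →ₘ[μ] ℂ, ∀ᵐ x ∂μ, ‖F x‖ₑ = f x := by
  have hm : AEStronglyMeasurable (fun x => ((f x).toReal : ℂ)) μ :=
    (Complex.measurable_ofReal.comp_aemeasurable hf.ennreal_toReal).aestronglyMeasurable
  refine ⟨AEEqFun.mk _ hm, ?_⟩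
  filter_upwards [AEEqFun.coeFn_mk _ hm, hfin] with x hx hfx
  rw [hx, ← ofReal_norm, Complex.norm_real, Real.norm_of_nonneg ENNReal.toReal_nonneg,
    ENNReal.ofReal_toReal hfx.ne]

theorem HasP2.cnorm_eq (h : HasP2 μ ρ) (hf : AEMeasurable f μ) {F : R →ₘ[μ] ℂ}
    (hF : ∀ᵐ x ∂μ, ‖F x‖ₑ = f x) : cnorm ρ F = ρ f :=
  h.congr (aemeasurable_enorm_aeeqFun F) hf hF

theorem HasQ1.cnorm_zero (h : HasQ1 μ ρ) : cnorm ρ (0 : R →ₘ[μ] ℂ) = 0 :=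
  (h.eq_zero_iff _ (aemeasurable_enorm_aeeqFun _)).2
    (AEEqFun.coeFn_zero.mono fun x hx => by rw [hx, Pi.zero_apply, enorm_zero])

theorem lt_top_of_space_subset (hρ : HasP2 μ ρ) (hσ : HasP2 μ σ) (h : space μ ρ ⊆ space μ σ)
    (hf : AEMeasurable f μ) (hfin : ∀ᵐ x ∂μ, f x < ∞) (hρf : ρ f < ∞) : σ f < ∞ := by
  obtain ⟨F, hF⟩ := exists_aeeqFun_enorm_eq hf hfin
  have hFρ : F ∈ space μ ρ := (hρ.cnorm_eq hf hF).trans_lt hρf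
  exact (hσ.cnorm_eq hf hF).ge.trans_lt (h hFρ)

theorem exists_mul_cnorm_le_one_cnorm_eq_one (hρ₁ : HasQ1 μ ρ) (hρ₂ : HasP2 μ ρ)
    (hσ₁ : HasQ1 μ σ) (hσ₂ : HasP2 μ σ) (h : space μ ρ ⊆ space μ σ) (hf : AEMeasurable f μ)
    {C : ℝ≥0} (hC : C ≠ 0) (hlt : C * ρ f < σ f) :
    ∃ F : R →ₘ[μ] ℂ, C * cnorm ρ F ≤ 1 ∧ cnorm σ F = 1 := by
  have hρf : ρ f < ∞ := lt_top_iff_ne_top.2 fun htop => by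
    rw [htop, ENNReal.mul_top (by simpa using hC)] at hlt
    exact not_top_lt hlt
  have hfin := ae_lt_top_of_lt_top hρ₁ hρ₂ hf hρf
  have hσf : σ f ≠ ∞ := (lt_top_of_space_subset hρ₂ hσ₂ h hf hfin hρf).ne
  have hσ0 : σ f ≠ 0 := (zero_le.trans_lt hlt).ne'
  obtain ⟨c, hc⟩ : ∃ c : ℝ≥0, c = (σ f)⁻¹ := ⟨_, ENNReal.coe_toNNReal (ENNReal.inv_ne_top.2 hσ0)⟩
  have hcf : AEMeasurable (fun x => c * f x) μ := by fun_prop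
  obtain ⟨F, hF⟩ := exists_aeeqFun_enorm_eq hcf
    (hfin.mono fun x hx => ENNReal.mul_lt_top ENNReal.coe_lt_top hx)
  refine ⟨F, ?_, ?_⟩
  · rw [hρ₂.cnorm_eq hcf hF, hρ₁.homogeneous c f hf, hc, mul_left_comm,
      ← ENNReal.inv_mul_cancel hσ0 hσf]
    gcongr
  · rw [hσ₂.cnorm_eq hcf hF, hσ₁.homogeneous c f hf, hc, ENNReal.inv_mul_cancel hσ0 hσf]

theorem dominatedBy_of_embeds (hρ₁ : HasQ1 μ ρ) (hρ₂ : HasP2 μ ρ) (hσ₁ : HasQ1 μ σ)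
    (hσ₂ : HasP2 μ σ) (h : Embeds μ ρ σ) : DominatedBy μ σ ρ := by
  by_contra hnd
  have hex (n : ℕ) : ∃ F : R →ₘ[μ] ℂ, (n + 1 : ℝ≥0) * cnorm ρ F ≤ 1 ∧ cnorm σ F = 1 := by
    obtain ⟨f, hf, hlt⟩ : ∃ f, AEMeasurable f μ ∧ (n + 1 : ℝ≥0) * ρ f < σ f := by
      by_contra! hle
      exact hnd ⟨n + 1, by positivity, hle⟩
    exact exists_mul_cnorm_le_one_cnorm_eq_one hρ₁ hρ₂ hσ₁ hσ₂ h.1 hf (by positivity) hlt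
  choose F hFρ hFσ using hex
  have hle (n : ℕ) : cnorm ρ (F n) ≤ (↑(n + 1) : ℝ≥0∞)⁻¹ := by
    rw [ENNReal.le_inv_iff_mul_le, mul_comm]
    exact_mod_cast hFρ n
  have hlim : Tendsto (fun n => cnorm ρ (F n)) atTop (𝓝 0) :=
    tendsto_of_tendsto_of_tendsto_of_le_of_le tendsto_const_nhds
      ((tendsto_add_atTop_iff_nat 1).2 ENNReal.tendsto_inv_nat_nhds_zero) (fun _ => zero_le) hle
  have hmem (n : ℕ) : F n ∈ space μ ρ :=
    (hle n).trans_lt (ENNReal.inv_lt_top.2 (by exact_mod_cast n.succ_pos))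
  have hzero : (0 : R →ₘ[μ] ℂ) ∈ space μ ρ := hρ₁.cnorm_zero.trans_lt ENNReal.zero_lt_top
  have hσlim := h.2 F 0 hmem hzero (by simpa only [sub_zero] using hlim)
  simp only [sub_zero, hFσ] at hσlim
  exact one_ne_zero (tendsto_nhds_unique tendsto_const_nhds hσlim)

/-! ### Integrable norms -/

theorem HasP4.integrableNorm (h : HasP4 μ ρ) : HasP4 μ (integrableNorm μ ρ) := by
  intro E hE hμE
  refine max_lt (h E hE hμE) ((sumNorm_le_two_mul_rearrangementIntegral_one μ _).trans_lt ?_)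
  rw [rearrangementIntegral_indicator_one]
  exact ENNReal.mul_lt_top ENNReal.ofNat_lt_top ((min_le_right _ _).trans_lt ENNReal.one_lt_top)

theorem integrableNorm_hasP5 [SFinite μ] : HasP5 μ (integrableNorm μ ρ) := by
  intro E hE hμE
  refine ⟨max 1 (μ E).toNNReal, fun f hf => ?_⟩
  calc ∫⁻ x in E, f x ∂μ ≤ rearrangementIntegral μ (μ E) f :=
        setLIntegral_le_rearrangementIntegral hf hE.nullMeasurableSet
    _ ≤ max 1 (μ E) * rearrangementIntegral μ 1 f := rearrangementIntegral_le_max_one_mul μ hμE.ne f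
    _ ≤ max 1 (μ E) * RIFunctionSpace.integrableNorm μ ρ f := by
        gcongr
        exact (rearrangementIntegral_one_le_sumNorm μ f).trans (le_max_right _ _)
    _ = (max 1 (μ E).toNNReal : ℝ≥0) * RIFunctionSpace.integrableNorm μ ρ f := by
        rw [ENNReal.coe_max, ENNReal.coe_one, ENNReal.coe_toNNReal hμE.ne]

theorem IsRearrangementInvariant.integrableNorm (h : IsRearrangementInvariant μ ρ) :
    IsRearrangementInvariant μ (integrableNorm μ ρ) := by
  intro f g hf hg hfg
  have hrearr : rearrangement μ f = rearrangement μ g := by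
    funext t
    simp only [rearrangement, hfg]
  simp only [RIFunctionSpace.integrableNorm, wienerLuxemburg, h f g hf hg hfg, hrearr]

theorem secondIntegrableAssociateNorm_isBanachFunctionNorm [SigmaFinite μ] :
    IsBanachFunctionNorm μ (secondIntegrableAssociateNorm μ ρ) :=
  associateNorm_isBanachFunctionNorm (associateNorm_hasP4 integrableNorm_hasP5).integrableNorm
    integrableNorm_hasP5

theorem IsResonant.rearrangementIntegral_le (hμ : IsResonant μ)
    (hri : IsRearrangementInvariant μ ρ) {E : Set R} (hE : MeasurableSet E) {C : ℝ≥0}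
    (hC : ∀ g, AEMeasurable g μ → ∫⁻ x in E, g x ∂μ ≤ C * ρ g) (hf : AEMeasurable f μ) :
    rearrangementIntegral μ (μ E) f ≤ C * ρ f := by
  rw [← lintegral_rearrangement_mul_indicator_one]
  simp only [mul_comm (rearrangement μ f _)]
  rw [← isResonant_iff.1 hμ _ f (measurable_const.indicator hE).aemeasurable hf]
  refine iSup₂_le fun h hh => iSup_le fun hhf => ?_
  simp only [mul_comm (E.indicator _ _)]
  rw [lintegral_mul_indicator_one μ h hE, ← hri h f hh hf hhf]
  exact hC h hh

theorem IsResonant.sumNorm_dominatedBy [SigmaFinite μ] (hμ : IsResonant μ)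
    (hri : IsRearrangementInvariant μ ρ) (h5 : HasP5 μ ρ) : DominatedBy μ (sumNorm μ) ρ := by
  obtain ⟨E, hE, hμE, hE1⟩ := exists_measurableSet_min_one_le μ
  obtain ⟨C, hC⟩ := h5 E hE hμE
  refine ⟨2 * (C + 1), by positivity, fun f hf => ?_⟩
  calc sumNorm μ f ≤ 2 * rearrangementIntegral μ 1 f :=
        sumNorm_le_two_mul_rearrangementIntegral_one μ f
    _ ≤ 2 * rearrangementIntegral μ (μ E) f := by
        gcongr
        exact rearrangementIntegral_one_le μ hE1 f
    _ ≤ 2 * (C * ρ f) := by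
        gcongr
        exact hμ.rearrangementIntegral_le hri hE hC hf
    _ ≤ (2 * (C + 1) : ℝ≥0) * ρ f := by
        rw [← mul_assoc]
        gcongr
        exact_mod_cast mul_le_mul_right (le_self_add : C ≤ C + 1) 2

theorem IsResonant.integrableNorm_dominatedBy [SigmaFinite μ] (hμ : IsResonant μ)
    (hri : IsRearrangementInvariant μ ρ) (h5 : HasP5 μ ρ) :
    DominatedBy μ (integrableNorm μ ρ) ρ :=
  .max_left (.of_le fun _ _ => le_rfl) (hμ.sumNorm_dominatedBy hri h5)

theorem dominatedBy_integrableNorm : DominatedBy μ ρ (integrableNorm μ ρ) :=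
  .of_le fun _ _ => le_max_left _ _

theorem IsResonant.dominatedBy_secondIntegrableAssociateNorm [SigmaFinite μ] (hμ : IsResonant μ)
    (hri : IsRearrangementInvariant μ ρ) (h1 : HasP1 μ ρ) (h2 : HasP2 μ ρ) (h3 : HasP3 μ ρ)
    (h4 : HasP4 μ ρ) : DominatedBy μ ρ (secondIntegrableAssociateNorm μ ρ) := by
  have hLL : DominatedBy μ ρ (associateNorm μ (associateNorm μ ρ)) :=
    .of_le fun f hf => le_associateNorm_associateNorm h1 h2 h3 hf
  have hassoc : DominatedBy μ (integrableNorm μ (integrableAssociateNorm μ ρ))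
      (integrableAssociateNorm μ ρ) :=
    hμ.integrableNorm_dominatedBy (hri.integrableNorm.associateNorm hμ)
      (associateNorm_hasP5 h4.integrableNorm integrableNorm_hasP5)
  exact hLL.trans (hassoc.trans dominatedBy_integrableNorm.associateNorm).associateNorm

theorem IsResonant.secondIntegrableAssociateNorm_dominatedBy [SigmaFinite μ] (hμ : IsResonant μ)
    (hri : IsRearrangementInvariant μ ρ) (h5 : HasP5 μ ρ) :
    DominatedBy μ (secondIntegrableAssociateNorm μ ρ) ρ := by
  have hassoc : DominatedBy μ (associateNorm μ (integrableAssociateNorm μ ρ))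
      (integrableNorm μ ρ) :=
    .of_le fun f hf =>
      associateNorm_associateNorm_le (fun g hg => integrableNorm_hasP5.eq_zero hg) hf
  exact dominatedBy_integrableNorm.associateNorm.trans
    (hassoc.trans (hμ.integrableNorm_dominatedBy hri h5))

/-! ### Resonance of atomless measures on the line -/

section AtomlessReal

variable {ν : Measure ℝ} {f : ℝ → ℝ≥0∞}

theorem continuous_measure_Iic [NullSingletonClass ν] (hν : ∀ x, ν (Iic x) ≠ ∞) :
    Continuous fun x => ν (Iic x) := by
  have : IsLocallyFiniteMeasure ν :=
    ⟨fun x => ⟨Iic (x + 1), Iic_mem_nhds (lt_add_one x), (hν _).lt_top⟩⟩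
  refine continuous_iff_continuousAt.2 fun x => ?_
  have hlim : Tendsto (fun y => ν (Icc (x - dist y x) (x + dist y x))) (𝓝 x) (𝓝 0) :=
    (tendsto_measure_Icc ν x).comp (tendsto_iff_dist_tendsto_zero.1 tendsto_id)
  have hIcc (y : ℝ) : uIcc x y ⊆ Icc (x - dist y x) (x + dist y x) := by
    rw [← Real.closedBall_eq_Icc]
    exact (convex_closedBall x _).ordConnected.uIcc_subset
      (Metric.mem_closedBall_self dist_nonneg) (Metric.mem_closedBall.2 le_rfl)
  have hle (a b : ℝ) : ν (Iic b) ≤ ν (Iic a) + ν (uIcc a b) :=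
    (measure_mono fun z hz => (le_total z a).imp id fun h =>
      Icc_subset_uIcc ⟨h, hz⟩).trans (measure_union_le _ _)
  refine tendsto_of_tendsto_of_tendsto_of_le_of_le
    (by simpa using ENNReal.Tendsto.sub (tendsto_const_nhds (x := ν (Iic x))) hlim (.inl (hν x)))
    (by simpa using hlim.const_add (ν (Iic x))) (fun y => ?_) (fun y => ?_)
  · exact tsub_le_iff_right.2 ((hle y x).trans (by rw [uIcc_comm]; gcongr; exact hIcc y))
  · exact (hle x y).trans (by gcongr; exact hIcc y)

theorem exists_measure_Iic_eq [NullSingletonClass ν] (hν : ∀ x, ν (Iic x) ≠ ∞) {e : ℝ≥0∞}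
    (h0 : e ≠ 0) (he : e < ν univ) : ∃ b, ν (Iic b) = e := by
  have hbot : ∃ a, ν (Iic a) < e := by
    have hlim := tendsto_measure_iInter_atBot (μ := ν)
      (fun x : ℝ => measurableSet_Iic.nullMeasurableSet) (fun _ _ => Iic_subset_Iic.2) ⟨0, hν 0⟩
    rw [iInter_Iic_eq_empty_iff.2 (by simp), measure_empty] at hlim
    exact (hlim.eventually_lt_const (pos_iff_ne_zero.2 h0)).exists
  have htop : ∃ b, e < ν (Iic b) := ((tendsto_measure_Iic_atTop ν).eventually_const_lt he).exists
  exact mem_range_of_exists_le_of_exists_ge (continuous_measure_Iic hν)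
    (hbot.imp fun _ => le_of_lt) (htop.imp fun _ => le_of_lt)

theorem measure_setOf_measure_Iic_lt [NullSingletonClass ν] (hν : ∀ x, ν (Iic x) ≠ ∞) {e : ℝ≥0∞}
    (he : e ≤ ν univ) : ν {x | ν (Iic x) < e} = e := by
  refine le_antisymm ?_ (le_of_forall_lt fun c hc => ?_)
  · rcases eq_or_ne e 0 with rfl | h0
    · simp
    rcases he.eq_or_lt with rfl | he
    · exact measure_mono (subset_univ _)
    obtain ⟨b, rfl⟩ := exists_measure_Iic_eq hν h0 he
    exact measure_mono fun x hx => (lt_of_not_ge fun h => hx.not_ge (measure_mono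
      (Iic_subset_Iic.2 h))).le
  · obtain ⟨d, hcd, hde⟩ := exists_between hc
    obtain ⟨b, rfl⟩ := exists_measure_Iic_eq hν (pos_of_gt hcd).ne' (hde.trans_le he)
    exact hcd.trans_le (measure_mono fun x hx =>
      (measure_mono (Iic_subset_Iic.2 hx)).trans_lt hde)

/-- The rank of `x` with respect to `f`: the measure of the set of points at which `f` is larger
than at `x`, where ties are broken by position. Composing `g^*` with the rank yields a
function equimeasurable with `g` that is large where `f` is large. -/
noncomputable def rank (ν : Measure ℝ) (f : ℝ → ℝ≥0∞) (x : ℝ) : ℝ≥0∞ :=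
  ν {y | f x < f y ∨ (f x = f y ∧ y ≤ x)}

theorem measurable_rank [SFinite ν] (hf : Measurable f) : Measurable (rank ν f) := by
  refine measurable_measure_prodMk_left
    (s := {q : ℝ × ℝ | f q.1 < f q.2 ∨ (f q.1 = f q.2 ∧ q.2 ≤ q.1)}) ?_
  rw [ofPred_or, ofPred_and]
  exact (measurableSet_lt (by fun_prop) (by fun_prop)).union
    ((measurableSet_eq_fun (by fun_prop) (by fun_prop)).inter
      (measurableSet_le (by fun_prop) (by fun_prop)))

theorem rank_le {v : ℝ≥0∞} {x : ℝ} (h : v < f x) : rank ν f x ≤ ν {y | v < f y} :=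
  measure_mono fun _ hy => hy.elim (fun h' => h.trans h') fun h' => h.trans_eq h'.1

theorem le_rank {s : Set ℝ} {x : ℝ} (h : ∀ y ∈ s, f x < f y) : ν s ≤ rank ν f x :=
  measure_mono fun y hy => Or.inl (h y hy)

theorem rank_eq_add (hf : Measurable f) (x : ℝ) :
    rank ν f x = ν {y | f x < f y} + ν.restrict {y | f y = f x} (Iic x) := by
  rw [Measure.restrict_apply measurableSet_Iic,
    ← measure_union' _ (measurableSet_lt measurable_const hf)]
  · refine congrArg ν (Set.ext fun y => or_congr_right ?_)
    exact and_comm.trans (and_congr_right fun _ => eq_comm)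
  · exact Set.disjoint_left.2 fun y hy hy' => hy.ne' hy'.2

theorem rank_lt_top (hν : ∀ x, ν (Iic x) ≠ ∞) (hf : Measurable f)
    (hsupp : ν {x | 0 < f x} ≠ ∞) (x : ℝ) : rank ν f x < ∞ := by
  have hsub : {y | f x < f y} ⊆ {y | 0 < f y} := fun y (hy : f x < f y) => zero_le.trans_lt hy
  rw [rank_eq_add hf]
  exact ENNReal.add_lt_top.2 ⟨(measure_mono hsub).trans_lt hsupp.lt_top,
    (Measure.restrict_apply_le _ _).trans_lt (hν x).lt_top⟩

/-- Up to the strictness of the inequality, the points of rank less than `t` are those above the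
level `v = f^*(t)`, together with an initial piece of the level set `{f = v}`. -/
theorem exists_measure_eq_setOf_rank_lt_subset [NullSingletonClass ν] (hν : ∀ x, ν (Iic x) ≠ ∞)
    (hf : Measurable f) (hsupp : ν {x | 0 < f x} ≠ ∞) {t : ℝ} (ht : ENNReal.ofReal t ≤ ν univ) :
    ∃ D, ν D = ENNReal.ofReal t ∧ {x | rank ν f x < ENNReal.ofReal t} ⊆ D ∧
      D ⊆ {x | rank ν f x ≤ ENNReal.ofReal t} := by
  obtain ⟨v, hv⟩ : ∃ v, v = rearrangement ν f t := ⟨_, rfl⟩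
  have habove : ν {x | v < f x} ≤ ENNReal.ofReal t := hv ▸ measure_setOf_rearrangement_lt_le
  have hlevel : MeasurableSet {x | f x = v} := measurableSet_eq_fun hf measurable_const
  have hdisj (A : Set ℝ) : Disjoint {x | v < f x} ({x | f x = v} ∩ A) :=
    Set.disjoint_left.2 fun y hy hy' => hy.ne' hy'.1
  have hge : ENNReal.ofReal t ≤ ν {x | v ≤ f x} :=
    hv ▸ le_measure_setOf_rearrangement_le hf.aemeasurable hsupp ht
  have hpiece : ENNReal.ofReal t - ν {x | v < f x} ≤ ν.restrict {x | f x = v} univ := by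
    rw [tsub_le_iff_left, Measure.restrict_apply_univ, ← inter_univ {x | f x = v},
      ← measure_union' (hdisj _) (measurableSet_lt measurable_const hf), inter_univ]
    exact hge.trans (measure_mono fun x (hx : v ≤ f x) => hx.lt_or_eq.imp id Eq.symm)
  refine ⟨{x | v < f x} ∪ {x | f x = v} ∩
    {x | ν.restrict {x | f x = v} (Iic x) < ENNReal.ofReal t - ν {x | v < f x}}, ?_, ?_, ?_⟩
  · rw [measure_union' (hdisj _) (measurableSet_lt measurable_const hf), inter_comm,
      ← Measure.restrict_apply' hlevel, measure_setOf_measure_Iic_lt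
      (fun x => ((Measure.restrict_apply_le _ _).trans_lt (hν x).lt_top).ne) hpiece,
      add_tsub_cancel_of_le habove]
  · intro x hx
    rcases lt_trichotomy v (f x) with h | rfl | h
    · exact Or.inl h
    · refine Or.inr ⟨rfl, ?_⟩
      rwa [mem_ofPred_eq, lt_tsub_iff_left, ← rank_eq_add hf]
    · exact absurd hx (hge.trans (le_rank fun y hy => h.trans_le hy)).not_gt
  · rintro x (h | ⟨rfl, h⟩)
    · exact (rank_le h).trans habove
    · rw [mem_ofPred_eq, rank_eq_add hf]
      exact (lt_tsub_iff_left.1 h).le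

theorem measure_setOf_rank_lt [NullSingletonClass ν] (hν : ∀ x, ν (Iic x) ≠ ∞)
    (hf : Measurable f) (hsupp : ν {x | 0 < f x} ≠ ∞) {d : ℝ≥0∞} (hd : d ≤ ν univ) :
    ν {x | rank ν f x < d} = d := by
  have hD (r : ℝ≥0) (hr : r ≤ ν univ) := exists_measure_eq_setOf_rank_lt_subset hν hf hsupp
    (t := r) (by rwa [ENNReal.ofReal_coe_nnreal])
  simp only [ENNReal.ofReal_coe_nnreal] at hD
  refine le_antisymm ?_ (ENNReal.le_of_forall_nnreal_lt fun r hr => ?_)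
  · induction d with
    | top => exact le_top
    | coe d =>
      obtain ⟨D, hD, hsub, -⟩ := hD d hd
      exact (measure_mono hsub).trans_eq hD
  · obtain ⟨D, hD, -, hsub⟩ := hD r (hr.le.trans hd)
    exact hD.ge.trans (measure_mono fun x hx => (hsub hx).trans_lt hr)

theorem measure_inter_setOf_rank_lt [NullSingletonClass ν] (hν : ∀ x, ν (Iic x) ≠ ∞)
    (hf : Measurable f) (hsupp : ν {x | 0 < f x} ≠ ∞) (s : ℝ≥0) {d : ℝ≥0∞} (hd : d ≤ ν univ) :
    ν ({x | (s : ℝ≥0∞) < f x} ∩ {x | rank ν f x < d}) = min (distribution ν f s) d := by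
  rcases le_or_gt d (distribution ν f s) with h | h
  · rw [min_eq_right h, inter_eq_right.2, measure_setOf_rank_lt hν hf hsupp hd]
    exact fun x hx => lt_of_not_ge fun hs =>
      hx.not_ge (h.trans (le_rank fun y hy => hs.trans_lt hy))
  · rw [min_eq_left h.le, inter_eq_left.2, distribution]
    exact fun x hx => (rank_le hx).trans_lt h

/-- For functions supported on a set of finite measure, the supremum in the definition of
resonance is attained. -/
theorem exists_equimeasurable_lintegral_mul_eq [SFinite ν] [NullSingletonClass ν]
    (hν : ∀ x, ν (Iic x) ≠ ∞) (hf : Measurable f) (hsupp : ν {x | 0 < f x} ≠ ∞)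
    (g : ℝ → ℝ≥0∞) :
    ∃ h : ℝ → ℝ≥0∞, Measurable h ∧ (∀ s, distribution ν h s = distribution ν g s) ∧
      ∫⁻ x, f x * h x ∂ν = ∫⁻ t, rearrangement ν f t * rearrangement ν g t ∂halfLine := by
  have hm : Measurable fun x => rearrangement ν g (rank ν f x).toReal :=
    (measurable_rearrangement ν g).comp (measurable_rank hf).ennreal_toReal
  have hset (s : ℝ≥0) : {x | (s : ℝ≥0∞) < rearrangement ν g (rank ν f x).toReal} =
      {x | rank ν f x < distribution ν g s} := by
    simp only [lt_rearrangement_iff, ENNReal.ofReal_toReal (rank_lt_top hν hf hsupp _).ne]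
  have hle (s : ℝ≥0) : distribution ν g s ≤ ν univ := measure_mono (subset_univ _)
  refine ⟨_, hm, fun s => ?_, ?_⟩
  · rw [distribution, hset, measure_setOf_rank_lt hν hf hsupp (hle s)]
  · rw [lintegral_mul_eq_lintegral_lintegral_measure_inter hf.aemeasurable hm.aemeasurable,
      lintegral_rearrangement_mul]
    refine lintegral_congr fun s => lintegral_congr fun t => ?_
    simp only [ENNReal.ofReal, hset, measure_inter_setOf_rank_lt hν hf hsupp _ (hle _)]

theorem isResonant_of_measure_Iic_ne_top [SFinite ν] [NullSingletonClass ν]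
    (hν : ∀ x, ν (Iic x) ≠ ∞) : IsResonant ν := by
  refine isResonant_of_le fun f g ⟨f', hf', hff'⟩ _ => ?_
  have hmono : Monotone fun n : ℕ => (Iic (n : ℝ)).indicator f' := fun m n hmn =>
    indicator_le_indicator_of_subset (Iic_subset_Iic.2 (Nat.cast_le.2 hmn)) fun _ => zero_le
  have hsup : f =ᵐ[ν] fun x => ⨆ n : ℕ, (Iic (n : ℝ)).indicator f' x := by
    filter_upwards [hff'] with x hx
    obtain ⟨n, hn⟩ := exists_nat_ge x
    rw [hx]
    exact le_antisymm (le_iSup_of_le n (indicator_of_mem (mem_Iic.2 hn) f').ge)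
      (iSup_le fun n => indicator_le_self _ _ x)
  rw [rearrangement_congr hsup, lintegral_rearrangement_iSup_mul ν hmono]
  refine iSup_le fun n => ?_
  have hsupp : ν {x | 0 < (Iic (n : ℝ)).indicator f' x} ≠ ∞ :=
    measure_ne_top_of_subset (fun x (hx : 0 < (Iic (n : ℝ)).indicator f' x) =>
      mem_of_indicator_ne_zero hx.ne') (hν n)
  obtain ⟨h, hh, heq, hint⟩ :=
    exists_equimeasurable_lintegral_mul_eq hν (hf'.indicator measurableSet_Iic) hsupp g
  rw [← hint]
  refine le_iSup₂_of_le h hh.aemeasurable (le_iSup_of_le heq (lintegral_mono_ae ?_))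
  filter_upwards [hff'] with x hx
  rw [hx]
  gcongr
  exact indicator_le_self _ _ x

end AtomlessReal

theorem isResonant_halfLine : IsResonant halfLine :=
  isResonant_of_measure_Iic_ne_top fun x => halfLine_Iic x ▸ ENNReal.ofReal_ne_top

/-! ### Lebesgue functionals -/

section Lebesgue

variable {p : ℝ} {E : Set R}

theorem lebesgueNorm_ofReal (hp : 0 < p) (f : R → ℝ≥0∞) :
    lebesgueNorm μ (ENNReal.ofReal p) f = (∫⁻ x, f x ^ p ∂μ) ^ (1 / p) := by
  rw [lebesgueNorm, eLpNorm_eq_lintegral_rpow_enorm_toReal (by simpa using hp) (by simp)]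
  simp only [ENNReal.toReal_ofReal hp.le, enorm_eq_self]

theorem lebesgueNorm_lt_top_iff (hp : 0 < p) :
    lebesgueNorm μ (ENNReal.ofReal p) f < ∞ ↔ ∫⁻ x, f x ^ p ∂μ < ∞ := by
  rw [lebesgueNorm_ofReal hp, ENNReal.rpow_lt_top_iff_of_pos (by positivity)]

theorem lebesgueNorm_indicator_one (hp : 0 < p) (hE : MeasurableSet E) :
    lebesgueNorm μ (ENNReal.ofReal p) (E.indicator fun _ => 1) = μ E ^ (1 / p) := by
  rw [lebesgueNorm, eLpNorm_indicator_const hE (by simpa using hp) (by simp)]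
  simp only [ENNReal.toReal_ofReal hp.le, enorm_eq_self, one_mul]

theorem lebesgueNorm_const_mul (hp : 0 < p) (a : ℝ≥0) (f : R → ℝ≥0∞) :
    lebesgueNorm μ (ENNReal.ofReal p) (fun x => a * f x) =
      a * lebesgueNorm μ (ENNReal.ofReal p) f := by
  simp only [lebesgueNorm_ofReal hp, ENNReal.mul_rpow_of_nonneg _ _ hp.le]
  rw [lintegral_const_mul' _ _ (ENNReal.rpow_ne_top_of_nonneg hp.le ENNReal.coe_ne_top),
    ENNReal.mul_rpow_of_nonneg _ _ (by positivity), ← ENNReal.rpow_mul, mul_one_div_cancel hp.ne',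
    ENNReal.rpow_one]

theorem lebesgueNorm_hasQ1 (hp : 0 < p) : HasQ1 μ (lebesgueNorm μ (ENNReal.ofReal p)) where
  homogeneous a f _ := lebesgueNorm_const_mul hp a f
  eq_zero_iff _ hf := eLpNorm_eq_zero_iff hf.aestronglyMeasurable (by simpa using hp)
  quasi_subadditive := by
    have hC := (ENNReal.ofReal p).LpAddConst_lt_top.ne
    refine ⟨max 1 (ENNReal.ofReal p).LpAddConst.toNNReal, le_max_left _ _, fun f g hf hg => ?_⟩
    refine (eLpNorm_add_le' hf.aestronglyMeasurable hg.aestronglyMeasurable _).trans ?_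
    rw [ENNReal.coe_max, ENNReal.coe_toNNReal hC]
    exact mul_le_mul_left (le_max_right _ _) _

theorem lebesgueNorm_hasP2 (p : ℝ≥0∞) : HasP2 μ (lebesgueNorm μ p) :=
  fun _ _ _ _ h => eLpNorm_mono_enorm_ae h

theorem lebesgueNorm_hasP3 (hp : 0 < p) : HasP3 μ (lebesgueNorm μ (ENNReal.ofReal p)) := by
  intro u f hu _ h
  have hmono : ∀ᵐ x ∂μ, Monotone fun n => u n x ^ p :=
    h.mono fun x hx m n hmn => ENNReal.rpow_le_rpow (hx.1 hmn) hp.le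
  have hlim : ∀ᵐ x ∂μ, Tendsto (fun n => u n x ^ p) atTop (𝓝 (f x ^ p)) :=
    h.mono fun x hx => (ENNReal.continuous_rpow_const.tendsto _).comp hx.2
  simp only [lebesgueNorm_ofReal hp]
  refine ⟨fun m n hmn => ENNReal.rpow_le_rpow (lintegral_mono_ae (hmono.mono fun x hx => hx hmn))
    (by positivity), (ENNReal.continuous_rpow_const.tendsto _).comp ?_⟩
  exact lintegral_tendsto_of_tendsto_of_monotone (fun n => (hu n).pow_const p) hmono hlim

theorem lebesgueNorm_hasP4 (hp : 0 < p) : HasP4 μ (lebesgueNorm μ (ENNReal.ofReal p)) := by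
  intro E hE hμE
  rw [lebesgueNorm_indicator_one hp hE]
  exact ENNReal.rpow_lt_top_of_nonneg (by positivity) hμE.ne

theorem distribution_rpow (hp : 0 < p) (f : R → ℝ≥0∞) (s : ℝ≥0) :
    distribution μ (fun x => f x ^ p) s = distribution μ f (s ^ p⁻¹) := by
  simp only [distribution, ENNReal.coe_rpow_of_nonneg s (inv_nonneg.2 hp.le),
    ENNReal.rpow_inv_lt_iff hp]

theorem lebesgueNorm_isRearrangementInvariant [SFinite μ] (hp : 0 < p) :
    IsRearrangementInvariant μ (lebesgueNorm μ (ENNReal.ofReal p)) := by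
  intro f g hf hg hfg
  rw [lebesgueNorm_ofReal hp, lebesgueNorm_ofReal hp,
    lintegral_eq_lintegral_distribution (hf.pow_const p),
    lintegral_eq_lintegral_distribution (hg.pow_const p)]
  simp only [distribution_rpow hp, hfg]

theorem lebesgueNorm_isRIQuasiBanachFunctionNorm [SFinite μ] (hp : 0 < p) :
    IsRIQuasiBanachFunctionNorm μ (lebesgueNorm μ (ENNReal.ofReal p)) where
  quasiBanach := ⟨lebesgueNorm_hasQ1 hp, lebesgueNorm_hasP2 _, lebesgueNorm_hasP3 hp,
    lebesgueNorm_hasP4 hp⟩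
  invariant := lebesgueNorm_isRearrangementInvariant hp

theorem not_hasP1_lebesgueNorm (hp : 0 < p) (hp1 : p < 1) {A B : Set R} (hA : MeasurableSet A)
    (hB : MeasurableSet B) (hAB : Disjoint A B) (hμ : μ B = μ A) (h0 : μ A ≠ 0)
    (htop : μ A ≠ ∞) : ¬ HasP1 μ (lebesgueNorm μ (ENNReal.ofReal p)) := by
  intro h
  have hsub := h.subadditive (A.indicator fun _ => 1) (B.indicator fun _ => 1)
    (measurable_const.indicator hA).aemeasurable (measurable_const.indicator hB).aemeasurable
  have hadd : (fun x => A.indicator (fun _ => (1 : ℝ≥0∞)) x + B.indicator (fun _ => 1) x) =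
      (A ∪ B).indicator fun _ => 1 :=
    (indicator_union_of_disjoint hAB _).symm
  rw [hadd, lebesgueNorm_indicator_one hp (hA.union hB), lebesgueNorm_indicator_one hp hA,
    lebesgueNorm_indicator_one hp hB, measure_union hAB hB, hμ, ← two_mul, ← two_mul,
    ENNReal.mul_rpow_of_nonneg _ _ (by positivity)] at hsub
  have hpow0 : μ A ^ (1 / p) ≠ 0 := by simp [h0, htop]
  have hpow : μ A ^ (1 / p) ≠ ∞ := ENNReal.rpow_ne_top_of_nonneg (by positivity) htop
  have hlt := ENNReal.rpow_lt_rpow_of_exponent_lt ENNReal.one_lt_two ENNReal.ofNat_ne_top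
    ((one_lt_div hp).2 hp1)
  rw [ENNReal.rpow_one] at hlt
  exact hlt.not_ge ((ENNReal.mul_le_mul_iff_left hpow0 hpow).1 hsub)

theorem integrableNorm_lebesgueNorm_indicator_one_le (hp : 0 < p) (hp1 : p ≤ 1)
    (hE : MeasurableSet E) (hμE : μ E ≤ 1) :
    integrableNorm μ (lebesgueNorm μ (ENNReal.ofReal p)) (E.indicator fun _ => 1) ≤ 2 * μ E := by
  refine max_le ?_ ((sumNorm_le_two_mul_rearrangementIntegral_one μ _).trans ?_)
  · calc lebesgueNorm μ (ENNReal.ofReal p) (E.indicator fun _ => 1) = μ E ^ (1 / p) :=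
          lebesgueNorm_indicator_one hp hE
      _ ≤ μ E ^ (1 : ℝ) := ENNReal.rpow_le_rpow_of_exponent_ge hμE (by rwa [one_le_div hp])
      _ = μ E := ENNReal.rpow_one _
      _ ≤ 2 * μ E := le_mul_of_one_le_left' one_le_two
  · rw [rearrangementIntegral_indicator_one]
    gcongr
    exact min_le_left _ _

theorem HasP5.setLIntegral_lt_top (h : HasP5 μ ρ) (hE : MeasurableSet E) (hμE : μ E < ∞)
    (hf : AEMeasurable f μ) (hρf : ρ f < ∞) : ∫⁻ x in E, f x ∂μ < ∞ := by
  obtain ⟨C, hC⟩ := h E hE hμE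
  exact (hC f hf).trans_lt (ENNReal.mul_lt_top ENNReal.coe_lt_top hρf)

end Lebesgue

/-! ### Lebesgue functionals with exponent below one on the half-line -/

section HalfLine

variable {p : ℝ} {E : Set ℝ}

theorem halfLine_restrict (hE : MeasurableSet E) (h0 : E ⊆ Ici 0) :
    halfLine.restrict E = volume.restrict E := by
  rw [halfLine, Measure.restrict_restrict hE, inter_eq_left.2 h0]

theorem halfLine_le_volume : halfLine ≤ volume :=
  Measure.restrict_le_self

theorem not_hasP1_lebesgueNorm_halfLine (hp : 0 < p) (hp1 : p < 1) :
    ¬ HasP1 halfLine (lebesgueNorm halfLine (ENNReal.ofReal p)) := by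
  have hIco : ∀ {a b : ℝ}, 0 ≤ a → halfLine (Ico a b) = ENNReal.ofReal (b - a) := fun ha => by
    rw [← Measure.restrict_apply_self,
      halfLine_restrict measurableSet_Ico fun x hx => ha.trans hx.1, Measure.restrict_apply_self,
      Real.volume_Ico]
  refine not_hasP1_lebesgueNorm hp hp1 measurableSet_Ico measurableSet_Ico
    (Ico_disjoint_Ico_same (a := (0 : ℝ)) (b := 1) (c := 2)) ?_ ?_ ?_
  all_goals norm_num [hIco]

/-- The power function `x ↦ x ^ r` restricted to a set `E` of positive numbers and extended by
zero, the source of all the counterexamples. -/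
noncomputable def powerOn (E : Set ℝ) (r : ℝ) : ℝ → ℝ≥0∞ :=
  E.indicator fun x => ENNReal.ofReal (x ^ r)

theorem measurable_powerOn (hE : MeasurableSet E) (r : ℝ) : Measurable (powerOn E r) :=
  (measurable_id.pow_const r).ennreal_ofReal.indicator hE

theorem powerOn_lt_top (E : Set ℝ) (r x : ℝ) : powerOn E r x < ∞ :=
  (indicator_le_self _ _ x).trans_lt ENNReal.ofReal_lt_top

theorem powerOn_rpow (hp : 0 < p) (h0 : E ⊆ Ioi 0) (r x : ℝ) :
    powerOn E r x ^ p = powerOn E (r * p) x := by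
  by_cases hx : x ∈ E
  · have hx0 : 0 < x := h0 hx
    simp only [powerOn, indicator_of_mem hx]
    rw [ENNReal.ofReal_rpow_of_nonneg (by positivity) hp.le, Real.rpow_mul hx0.le]
  · simp [powerOn, hx, hp]

theorem lintegral_powerOn_lt_top_iff (hE : MeasurableSet E) (h0 : E ⊆ Ioi 0) (r : ℝ) :
    ∫⁻ x, powerOn E r x ∂halfLine < ∞ ↔ IntegrableOn (fun x => x ^ r) E := by
  have hm : AEStronglyMeasurable (fun x : ℝ => x ^ r) (volume.restrict E) :=
    (measurable_id.pow_const r).aestronglyMeasurable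
  simp only [powerOn]
  rw [lintegral_indicator hE, halfLine_restrict hE (h0.trans Ioi_subset_Ici_self), IntegrableOn,
    Integrable, and_iff_right hm, hasFiniteIntegral_iff_ofReal]
  exact (ae_restrict_mem hE).mono fun x hx => Real.rpow_nonneg (le_of_lt (h0 hx)) r

theorem lebesgueNorm_powerOn_lt_top_iff (hp : 0 < p) (hE : MeasurableSet E) (h0 : E ⊆ Ioi 0)
    (r : ℝ) : lebesgueNorm halfLine (ENNReal.ofReal p) (powerOn E r) < ∞ ↔
      IntegrableOn (fun x => x ^ (r * p)) E := by
  rw [lebesgueNorm_lt_top_iff hp, ← lintegral_powerOn_lt_top_iff hE h0]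
  simp only [powerOn_rpow hp h0]

theorem lebesgueNorm_powerOn_Ioo_neg_one_lt_top (hp : 0 < p) (hp1 : p < 1) :
    lebesgueNorm halfLine (ENNReal.ofReal p) (powerOn (Ioo 0 1) (-1)) < ∞ := by
  rw [lebesgueNorm_powerOn_lt_top_iff hp measurableSet_Ioo Ioo_subset_Ioi_self,
    intervalIntegral.integrableOn_Ioo_rpow_iff one_pos]
  linarith

theorem HasP5.powerOn_Ioo_neg_one_eq_top {ρ : (ℝ → ℝ≥0∞) → ℝ≥0∞} (h : HasP5 halfLine ρ) :
    ρ (powerOn (Ioo 0 1) (-1)) = ∞ := by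
  by_contra hne
  have hfin : halfLine (Ioo 0 1) < ∞ := (halfLine_le_volume _).trans_lt (by simp)
  have hlt := h.setLIntegral_lt_top measurableSet_Ioo hfin
    (measurable_powerOn measurableSet_Ioo (-1)).aemeasurable (lt_top_iff_ne_top.2 hne)
  rw [← lintegral_indicator measurableSet_Ioo, powerOn, indicator_indicator, inter_self] at hlt
  have hint := (lintegral_powerOn_lt_top_iff measurableSet_Ioo Ioo_subset_Ioi_self _).1 hlt
  exact lt_irrefl _ ((intervalIntegral.integrableOn_Ioo_rpow_iff one_pos).1 hint)

theorem not_hasP5_lebesgueNorm_halfLine (hp : 0 < p) (hp1 : p < 1) :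
    ¬ HasP5 halfLine (lebesgueNorm halfLine (ENNReal.ofReal p)) :=
  fun h => (lebesgueNorm_powerOn_Ioo_neg_one_lt_top hp hp1).ne h.powerOn_Ioo_neg_one_eq_top

theorem not_space_lebesgueNorm_subset (hp : 0 < p) (hp1 : p < 1) :
    ¬ space halfLine (lebesgueNorm halfLine (ENNReal.ofReal p)) ⊆
      space halfLine (secondIntegrableAssociateNorm halfLine
        (lebesgueNorm halfLine (ENNReal.ofReal p))) := by
  intro hsub
  have hBan := secondIntegrableAssociateNorm_isBanachFunctionNorm (μ := halfLine)
    (ρ := lebesgueNorm halfLine (ENNReal.ofReal p))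
  have hlt := lt_top_of_space_subset (lebesgueNorm_hasP2 _) hBan.p2 hsub
    (measurable_powerOn measurableSet_Ioo (-1)).aemeasurable
    (Eventually.of_forall (powerOn_lt_top _ _)) (lebesgueNorm_powerOn_Ioo_neg_one_lt_top hp hp1)
  exact hlt.ne hBan.p5.powerOn_Ioo_neg_one_eq_top

theorem ae_le_two_mul_integrableAssociateNorm_lebesgueNorm (hp : 0 < p) (hp1 : p ≤ 1)
    {g : ℝ → ℝ≥0∞} (hg : AEMeasurable g halfLine) : ∀ᵐ x ∂halfLine,
      g x ≤ 2 * integrableAssociateNorm halfLine (lebesgueNorm halfLine (ENNReal.ofReal p)) g := by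
  set A := integrableAssociateNorm halfLine (lebesgueNorm halfLine (ENNReal.ofReal p)) g
  have hloc (n : ℤ) : ∀ᵐ x ∂halfLine.restrict (Ico n (n + 1)), g x ≤ 2 * A := by
    refine ae_restrict_le_mul_associateNorm (C := 2) hg measurableSet_Ico
      (fun E hE h => integrableNorm_hasP5.eq_zero_of_indicator hE h) fun E hEn hE => ?_
    have hE1 : halfLine E ≤ 1 := by
      refine (halfLine_le_volume E).trans ((measure_mono hEn).trans ?_)
      simp
    exact integrableNorm_lebesgueNorm_indicator_one_le hp hp1 hE hE1
  rwa [← ae_restrict_iUnion_iff, iUnion_Ico_intCast, Measure.restrict_univ] at hloc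

theorem secondIntegrableAssociateNorm_lebesgueNorm_le (hp : 0 < p) (hp1 : p ≤ 1)
    {f : ℝ → ℝ≥0∞} (hf : AEMeasurable f halfLine) :
    secondIntegrableAssociateNorm halfLine (lebesgueNorm halfLine (ENNReal.ofReal p)) f ≤
      2 * ∫⁻ x, f x ∂halfLine := by
  refine associateNorm_le fun g hg _ => ENNReal.div_le_of_le_mul ?_
  set A := integrableAssociateNorm halfLine (lebesgueNorm halfLine (ENNReal.ofReal p))
  calc ∫⁻ x, f x * g x ∂halfLine
      ≤ ∫⁻ x, f x * (2 * A g) ∂halfLine :=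
        lintegral_mono_ae ((ae_le_two_mul_integrableAssociateNorm_lebesgueNorm hp hp1 hg).mono
          fun x hx => by gcongr)
    _ = 2 * (∫⁻ x, f x ∂halfLine) * A g := by
        rw [lintegral_mul_const'' _ hf]
        ring
    _ ≤ 2 * (∫⁻ x, f x ∂halfLine) * integrableNorm halfLine A g := by
        gcongr
        exact le_max_left _ _

theorem not_space_secondIntegrableAssociateNorm_subset (hp : 0 < p) (hp1 : p < 1) :
    ¬ space halfLine (secondIntegrableAssociateNorm halfLine
        (lebesgueNorm halfLine (ENNReal.ofReal p))) ⊆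
      space halfLine (lebesgueNorm halfLine (ENNReal.ofReal p)) := by
  intro hsub
  have h0 : Ioi (1 : ℝ) ⊆ Ioi 0 := Ioi_subset_Ioi zero_le_one
  have hf := (measurable_powerOn measurableSet_Ioi (E := Ioi 1) (-p⁻¹)).aemeasurable (μ := halfLine)
  have hint : ∫⁻ x, powerOn (Ioi 1) (-p⁻¹) x ∂halfLine < ∞ := by
    rw [lintegral_powerOn_lt_top_iff measurableSet_Ioi h0, integrableOn_Ioi_rpow_iff one_pos]
    exact neg_lt_neg ((one_lt_inv₀ hp).2 hp1)
  have hlt := lt_top_of_space_subset secondIntegrableAssociateNorm_isBanachFunctionNorm.p2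
    (lebesgueNorm_hasP2 _) hsub hf (Eventually.of_forall (powerOn_lt_top _ _))
    ((secondIntegrableAssociateNorm_lebesgueNorm_le hp hp1.le hf).trans_lt
      (ENNReal.mul_lt_top ENNReal.ofNat_lt_top hint))
  rw [lebesgueNorm_powerOn_lt_top_iff hp measurableSet_Ioi h0, neg_mul, inv_mul_cancel₀ hp.ne',
    integrableOn_Ioi_rpow_iff one_pos] at hlt
  exact lt_irrefl _ hlt

end HalfLine

end RIFunctionSpace

open RIFunctionSpace in
theorem mainTheorem7 {R : Type*} [MeasurableSpace R] (μ : Measure R) [SigmaFinite μ]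
    (hμ : IsResonant μ) (ρ : (R → ℝ≥0∞) → ℝ≥0∞) (hρ : IsRIQuasiBanachFunctionNorm μ ρ) :
    (IsBanachFunctionNorm μ ρ →
      space μ ρ = space μ (secondIntegrableAssociateNorm μ ρ) ∧
      Equivalent μ ρ (secondIntegrableAssociateNorm μ ρ)) ∧
    (HasP5 μ ρ → (¬ ∃ σ : (R → ℝ≥0∞) → ℝ≥0∞, IsBanachFunctionNorm μ σ ∧ Equivalent μ ρ σ) →
      Embeds μ ρ (secondIntegrableAssociateNorm μ ρ) ∧
      ¬ Embeds μ (secondIntegrableAssociateNorm μ ρ) ρ) ∧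
    (HasP1 μ ρ → ¬ HasP5 μ ρ →
      Embeds μ (secondIntegrableAssociateNorm μ ρ) ρ ∧
      ¬ Embeds μ ρ (secondIntegrableAssociateNorm μ ρ)) ∧
    (IsResonant halfLine ∧ ∀ p : ℝ, 0 < p → p < 1 →
      IsRIQuasiBanachFunctionNorm halfLine (lebesgueNorm halfLine (ENNReal.ofReal p)) ∧
      ¬ HasP1 halfLine (lebesgueNorm halfLine (ENNReal.ofReal p)) ∧
      ¬ HasP5 halfLine (lebesgueNorm halfLine (ENNReal.ofReal p)) ∧
      ¬ space halfLine (lebesgueNorm halfLine (ENNReal.ofReal p)) ⊆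
        space halfLine (secondIntegrableAssociateNorm halfLine
          (lebesgueNorm halfLine (ENNReal.ofReal p))) ∧
      ¬ space halfLine (secondIntegrableAssociateNorm halfLine
          (lebesgueNorm halfLine (ENNReal.ofReal p))) ⊆
        space halfLine (lebesgueNorm halfLine (ENNReal.ofReal p))) := by
  have hBan : IsBanachFunctionNorm μ (secondIntegrableAssociateNorm μ ρ) :=
    secondIntegrableAssociateNorm_isBanachFunctionNorm
  obtain ⟨⟨hQ1, hP2, hP3, hP4⟩, hri⟩ := hρ
  have hle_of_p1 (h1 : HasP1 μ ρ) : DominatedBy μ ρ (secondIntegrableAssociateNorm μ ρ) :=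
    hμ.dominatedBy_secondIntegrableAssociateNorm hri h1 hP2 hP3 hP4
  have hge_of_p5 (h5 : HasP5 μ ρ) : DominatedBy μ (secondIntegrableAssociateNorm μ ρ) ρ :=
    hμ.secondIntegrableAssociateNorm_dominatedBy hri h5
  refine ⟨fun hB => ⟨?_, (hle_of_p1 hB.p1).equivalent (hge_of_p5 hB.p5)⟩,
    fun h5 hne => ⟨(hge_of_p5 h5).embeds, fun hE => hne ⟨_, hBan, ?_⟩⟩,
    fun h1 h5 => ⟨(hle_of_p1 h1).embeds, fun hE => h5 ?_⟩,
    isResonant_halfLine, fun p hp hp1 => ⟨lebesgueNorm_isRIQuasiBanachFunctionNorm hp,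
      not_hasP1_lebesgueNorm_halfLine hp hp1, not_hasP5_lebesgueNorm_halfLine hp hp1,
      not_space_lebesgueNorm_subset hp hp1, not_space_secondIntegrableAssociateNorm_subset hp hp1⟩⟩
  · exact (hge_of_p5 hB.p5).space_subset.antisymm (hle_of_p1 hB.p1).space_subset
  · exact (dominatedBy_of_embeds hBan.p1.hasQ1 hBan.p2 hQ1 hP2 hE).equivalent (hge_of_p5 h5)
  · exact hBan.p5.of_dominatedBy (dominatedBy_of_embeds hQ1 hP2 hBan.p1.hasQ1 hBan.p2 hE)
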